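/- Let $N\ge 1$. For a modular form $f$ on $\Gamma_0(N)$ let $\nu(f)\in\mathbb N\cup\{\infty\}$ be its order of vanishing at $q=0$, $q=e^{2i\pi\tau}$ (with $\nu(0)=\infty$); $f$ is *unitary* if $f=q^{\nu(f)}+O(q^{\nu(f)+1})$ with $\nu(f)<\infty$. A *strong modular form* of level $N$ is a unitary modular form for $\Gamma_0(N)$, of some weight $\rho\in\mathbb N$, that vanishes at the cusp $\infty$, but at no point of the upper half plane and at no cusp inequivalent to $\infty$ under $\Gamma_0(N)$. $\Delta_N$ denotes the strong modular form of level $N$ of least weight, and $\rho_N$ its weight. Put $\delta_{2k}(N)=\dim S_{2k}(\Gamma_0(N))$. A basis $(F^{(s)})_{1\le s\le\delta}$ of a space of cusp forms on $\Gamma_0(N)$ is *unitary upper triangular* if its elements are unitary and $\nu(F^{(1)})<\nu(F^{(2)})<\cdots$. Then $\Delta_N$ exists, and the following holds for every $k\ge 1$ with $(\Delta,\rho)=(\Delta_N,\rho_N)$ and, more generally, for every strong modular form $\Delta$ of level $N$ and weight $\rho$. 1. The map $\Phi\mapsto\Delta\,\Phi$ is an isomorphism of $S_{2k}(\Gamma_0(N))$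 onto $\{\Phi\in S_{2k+\rho}(\Gamma_0(N)) : \nu(\Phi)>\nu(\Delta)\}$. 2. For every unitary upper triangular basis $(F_{2k+\rho}^{(s)})_s$ of $S_{2k+\rho}(\Gamma_0(N))$, $$S_{2k+\rho}(\Gamma_0(N))=\mathrm{Vect}\bigl(F_{2k+\rho}^{(s)} : \nu(F_{2k+\rho}^{(s)})\le\nu(\Delta)\bigr)\oplus\Delta\cdot S_{2k}(\Gamma_0(N)).$$ 3. $S_{2k}(\Gamma_0(N))$ has a unitary upper triangular basis, and for every such basis $(F_{2k}^{(s)})_s$ there is a unitary upper triangular basis $(F_{2k+\rho}^{(s)})_s$ of $S_{2k+\rho}(\Gamma_0(N))$ such that, with $m$ the number of indices $s$ for which $\nu(F_{2k+\rho}^{(s)})\le\nu(\Delta)$, $$F_{2k+\rho}^{(s)}=\Delta\cdot F_{2k}^{(s-m)}\qquad (m+1\le s\le\delta_{2k+\rho}(N)),$$ and, if moreover $k\ge 2$, $$F_{2k+\rho}^{(s)}=\Delta\cdot F_{2k}^{(s-\nu(\Delta))}\qquad (\nu(\Delta)+1\le s\le\delta_{2k+\rho}(N)).$$ In particular the indices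 $s-m$ and $s-\nu(\Delta)$ lie between $1$ and $\delta_{2k}(N)$. -/

import Mathlib

open UpperHalfPlane ModularForm
open scoped MatrixGroups

noncomputable section

/-- The congruence subgroup `Γ₀(N)` of `SL(2, ℤ)`, as a subgroup of `GL(2, ℝ)`. -/
abbrev GammaZero (N : ℕ) : Subgroup (GL (Fin 2) ℝ) :=
  (CongruenceSubgroup.Gamma0 N : Subgroup (GL (Fin 2) ℝ))

/-- The space `M_k(Γ₀(N))` of modular forms. -/
abbrev ModForms (N : ℕ) (k : ℤ) : Type := ModularForm (GammaZero N) k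

/-- The space `S_k(Γ₀(N))` of cusp forms. -/
abbrev CuspForms (N : ℕ) (k : ℤ) : Type := CuspForm (GammaZero N) k

/-- The dimension of `S_k(Γ₀(N))`. -/
def cuspDim (N : ℕ) (k : ℤ) : ℕ := Module.finrank ℂ (CuspForms N k)

/-- The valuation `ν(f)`: the order of vanishing at `q = 0` of the expansion of `f` in
`q = exp (2πiτ)`; it is `⊤` for `f = 0`. -/
def valuation (f : ℍ → ℂ) : ℕ∞ := (qExpansion 1 f).order

/-- `f` is unitary: `f = q ^ n + O(q ^ (n + 1))` with `n = ν(f)` finite. -/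
def IsUnitary (f : ℍ → ℂ) : Prop :=
  ∃ n : ℕ, valuation f = n ∧ (qExpansion 1 f).coeff n = 1

/-- A unitary strong modular form of level `N`: it vanishes at the cusp `∞`, nowhere on the upper
half plane, and at no cusp that is not equivalent to `∞` under `Γ₀(N)`; its leading `q`-coefficient
is `1`. -/
structure IsStrongModularForm {N : ℕ} {ρ : ℤ} (D : ModForms N ρ) : Prop where
  isZeroAtImInfty : IsZeroAtImInfty D
  ne_zero : ∀ τ : ℍ, D τ ≠ 0
  not_isZeroAt : ∀ c : OnePoint ℝ, IsCusp c (GammaZero N) →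
    (∀ g ∈ GammaZero N, g • (OnePoint.infty : OnePoint ℝ) ≠ c) → ¬ c.IsZeroAt D ρ
  isUnitary : IsUnitary D

/-- `ρ_N`: the least weight of a unitary strong modular form of level `N`. -/
def deltaWeight (N : ℕ) : ℕ := sInf {ρ : ℕ | ∃ D : ModForms N ρ, IsStrongModularForm D}

open Classical in
/-- `Δ_N`: the unitary strong modular form of level `N` of least weight. -/
def deltaForm (N : ℕ) : ModForms N (deltaWeight N) :=
  if h : ∃ D : ModForms N (deltaWeight N), IsStrongModularForm D then h.choose else 0

/-- Multiplication by a modular form `D` of weight `ρ`, as a linear map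
`S_k(Γ₀(N)) → S_{k+ρ}(Γ₀(N))`. -/
def mulCusp {N : ℕ} {ρ : ℤ} (D : ModForms N ρ) (k : ℤ) :
    CuspForms N k →ₗ[ℂ] CuspForms N (k + ρ) where
  toFun f :=
    { toFun := fun τ => D τ * f τ
      slash_action_eq' := fun γ hγ => by
        have h := (f.toSlashInvariantForm.mul D.toSlashInvariantForm).slash_action_eq' γ hγ
        have e : (fun τ => D τ * f τ) =
            (f.toSlashInvariantForm.mul D.toSlashInvariantForm : ℍ → ℂ) := by
          funext τ
          exact mul_comm _ _
        rw [e]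
        exact h
      holo' := D.holo'.mul f.holo'
      zero_at_cusps' := fun {c} hc g hg => by
        have h1 := D.bdd_at_cusps' hc g hg
        have h2 := f.zero_at_cusps' hc g hg
        have e : (fun τ => D τ * f τ) = (f.toFun * D.toFun : ℍ → ℂ) := by
          funext τ
          exact mul_comm _ _
        rw [e, mul_slash]
        have h3 : IsZeroAtImInfty ((f.toFun ∣[k] g) * (D.toFun ∣[ρ] g)) :=
          Filter.ZeroAtFilter.mul_boundedAtFilter h2 h1
        have h4 := h3.smul (|g.det.val| : ℝ)
        exact h4 }
  map_add' f g := by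
    ext τ
    exact mul_add _ _ _
  map_smul' a f := by
    ext τ
    exact mul_left_comm _ _ _

@[simp] lemma mulCusp_apply {N : ℕ} {ρ : ℤ} (D : ModForms N ρ) (k : ℤ) (f : CuspForms N k)
    (τ : ℍ) : mulCusp D k f τ = D τ * f τ := rfl

/-- A basis `(F 0, …, F (d - 1))` of `S_k(Γ₀(N))`, `d = dim S_k(Γ₀(N))`, is unitary upper
triangular if its elements are unitary and their valuations strictly increase. -/
structure IsUnitaryUpperTriangular {N : ℕ} {k : ℤ}
    (F : Module.Basis (Fin (cuspDim N k)) ℂ (CuspForms N k)) : Prop where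
  isUnitary : ∀ i, IsUnitary (F i)
  strictMono : StrictMono fun i => valuation (F i)

end

/-!
Let `D` be a strong modular form of level `N` and weight `ρ`.

**Division.** By definition `D` has no zeros outside the cusp `∞`: translated to an inequivalent
cusp it tends to a nonzero limit (`IsStrongModularForm.exists_tendsto_slash`). Hence, for a cusp
form `Φ` of weight `k + ρ` with `ν(D) < ν(Φ)`, the quotient `Φ / D` is a cusp form of weight `k`
(`IsStrongModularForm.mem_range_mulCusp_iff`). As there are no cusp forms of weight `≤ 0`, and as
`D S_k` is cut out in `S_{k+ρ}` by the vanishing of finitely many `q`-coefficients, repeated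
division also shows that every `S_k` is finite dimensional
(`IsStrongModularForm.finiteDimensional`).

**Triangular bases.** In a finite-dimensional space of power series, the dimension is the number of
orders that occur, and an element is a combination of those members of a triangular basis whose
order is at least its own. This gives the existence of triangular bases, the direct sum
decomposition (`IsStrongModularForm.isCompl_range_mulCusp`), and the possibility of completing
`D F⁽¹⁾, D F⁽²⁾, …` to a triangular basis of `S_{k+ρ}` by `m` forms of valuation `≤ ν(D)`
(`IsStrongModularForm.exists_isUnitaryUpperTriangular_extending`).

**The equality `m = ν(D)` in weight `2k ≥ 4`.** It means that `1, …, ν(D)` all are valuations of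
cusp forms of weight `2k + ρ`. The Poincaré series `∑ (cτ + d)^{-2k} exp (-2πi j γτ)`, over the
bottom rows `(c, d)` of the matrices `γ` in `Γ₀(N)`, converges absolutely, has a pole of order `j`
at `∞`, and vanishes at the other cusps; its product with `D` is a cusp form of valuation
`ν(D) - j`, for `0 ≤ j < ν(D)` (`exists_cuspForm_valuation_eq`). This replaces a dimension formula.

**Existence.** A multiple of `∏ Δ(dτ) ^ (d μ(N / d))`, over the divisors `d` of `N`, is a strong
modular form of weight `12 φ(N)` (`exists_isStrongModularForm`). Indeed, the order of `Δ(dτ)` at the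
cusp `g ∞`, in terms of `q`, is `gcd(d, c)² / d`, where `c = g₁₀`
(`exists_tendsto_norm_scaledDiscriminant_slash`), so that of the product is
`∑ μ(N / d) gcd(d, c)²`. By Möbius inversion this is `0` if `N` does not divide `c`, and Jordan's
totient `J₂(N) > 0` otherwise.
-/

open Filter Topology Manifold Function CongruenceSubgroup Matrix.SpecialLinearGroup

local notation "𝕢" => Function.Periodic.qParam

noncomputable section

/-! ### Leading terms of `q`-expansions -/

/-- If the `q`-expansion of `f` (in the local parameter of width `h`) has no terms of degree below
`n`, then `f / q ^ n` tends at `i∞` to the coefficient of degree `n`. -/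
lemma tendsto_div_qParam_pow {f : ℍ → ℂ} {h : ℝ} (hh : 0 < h) (hper : Periodic (f ∘ ofComplex) h)
    (hhol : MDiff f) (hbdd : IsBoundedAtImInfty f) {n : ℕ}
    (hn : ∀ m < n, (qExpansion h f).coeff m = 0) :
    Tendsto (fun τ : ℍ ↦ f τ / 𝕢 h τ ^ n) atImInfty (𝓝 ((qExpansion h f).coeff n)) := by
  have hps := (analyticAt_cuspFunction_zero hh hper hhol hbdd).hasFPowerSeriesAt
  have hO := (hps.isBigO_sub_partialSum_pow (n + 1)).comp_tendsto (qParam_tendsto_atImInfty hh)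
  have key (τ : ℍ) : (FormalMultilinearSeries.ofScalars ℂ fun n ↦
      iteratedDeriv n (cuspFunction h f) 0 / (n.factorial : ℂ)).partialSum (n + 1) (𝕢 h τ)
      = (qExpansion h f).coeff n * 𝕢 h τ ^ n := by
    rw [FormalMultilinearSeries.partialSum, Finset.sum_range_succ, Finset.sum_eq_zero, zero_add]
    · simp only [qExpansion_coeff, FormalMultilinearSeries.ofScalars_apply_eq, smul_eq_mul]
      ring
    · intro m hm
      have := hn m (Finset.mem_range.mp hm)
      rw [qExpansion_coeff, mul_comm, ← div_eq_mul_inv] at this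
      simp [FormalMultilinearSeries.ofScalars, this]
  rw [← tendsto_sub_nhds_zero_iff]
  have hO' : (fun τ : ℍ ↦ f τ / 𝕢 h τ ^ n - (qExpansion h f).coeff n) =O[atImInfty]
      fun τ : ℍ ↦ 𝕢 h τ := by
    rw [Asymptotics.isBigO_iff] at hO ⊢
    obtain ⟨C, hC⟩ := hO
    refine ⟨C, hC.mono fun τ hτ ↦ ?_⟩
    have hq : 𝕢 h τ ≠ 0 := Periodic.qParam_ne_zero _
    simp only [comp_apply, zero_add, key, eq_cuspFunction τ hh.ne' hper, norm_pow, norm_norm]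
      at hτ
    have e : f τ / 𝕢 h τ ^ n - (qExpansion h f).coeff n =
        (f τ - (qExpansion h f).coeff n * 𝕢 h τ ^ n) / 𝕢 h τ ^ n := by
      field_simp
    rw [e, norm_div, norm_pow, div_le_iff₀ (by positivity)]
    calc _ ≤ _ := hτ
      _ = _ := by ring
  exact hO'.trans_tendsto (qParam_tendsto_atImInfty hh)

lemma tendsto_valueAtInfty {f : ℍ → ℂ} {h : ℝ} (hh : 0 < h) (hper : Periodic (f ∘ ofComplex) h)
    (hhol : MDiff f) (hbdd : IsBoundedAtImInfty f) :
    Tendsto f atImInfty (𝓝 ((qExpansion h f).coeff 0)) := by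
  simpa using tendsto_div_qParam_pow hh hper hhol hbdd (n := 0) (by simp)

lemma isBoundedAtImInfty_of_tendsto {f : ℍ → ℂ} {c : ℂ} (hf : Tendsto f atImInfty (𝓝 c)) :
    IsBoundedAtImInfty f :=
  hf.isBigO_one ℝ

lemma tendsto_of_tendsto_div_qParam_pow {f : ℍ → ℂ} {n m : ℕ} (hmn : m < n) {c : ℂ}
    (hf : Tendsto (fun τ : ℍ ↦ f τ / 𝕢 1 τ ^ n) atImInfty (𝓝 c)) :
    Tendsto (fun τ : ℍ ↦ f τ / 𝕢 1 τ ^ m) atImInfty (𝓝 0) := by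
  have h0 := (qParam_tendsto_atImInfty one_pos).pow (n - m)
  rw [zero_pow (by omega)] at h0
  have := hf.mul h0
  rw [mul_zero] at this
  refine this.congr fun τ ↦ ?_
  have hq : 𝕢 1 τ ≠ 0 := Periodic.qParam_ne_zero _
  have e : 𝕢 1 τ ^ n = 𝕢 1 τ ^ m * 𝕢 1 τ ^ (n - m) := by rw [← pow_add]; congr 1; omega
  rw [e]
  field_simp

lemma isBoundedAtImInfty_of_tendsto_div_qParam_pow {f : ℍ → ℂ} {n : ℕ} {c : ℂ}
    (hf : Tendsto (fun τ : ℍ ↦ f τ / 𝕢 1 τ ^ n) atImInfty (𝓝 c)) : IsBoundedAtImInfty f := by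
  rcases Nat.eq_zero_or_pos n with rfl | hn
  · exact isBoundedAtImInfty_of_tendsto (by simpa using hf)
  · exact isBoundedAtImInfty_of_tendsto (by simpa using tendsto_of_tendsto_div_qParam_pow hn hf)

/-- The `q`-expansion of `f` starts with `c * q ^ n` as soon as `f / q ^ n → c` at `i∞`. -/
lemma coeff_of_tendsto_div_qParam_pow {f : ℍ → ℂ} (hper : Periodic (f ∘ ofComplex) 1)
    (hhol : MDiff f) {n : ℕ} {c : ℂ}
    (hf : Tendsto (fun τ : ℍ ↦ f τ / 𝕢 1 τ ^ n) atImInfty (𝓝 c)) :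
    (∀ m < n, (qExpansion 1 f).coeff m = 0) ∧ (qExpansion 1 f).coeff n = c := by
  have hper' : Periodic (f ∘ ofComplex) ((1 : ℝ) : ℂ) := by simpa using hper
  have hbdd := isBoundedAtImInfty_of_tendsto_div_qParam_pow hf
  have h1 : ∀ m < n, (qExpansion 1 f).coeff m = 0 := by
    intro m
    induction m using Nat.strong_induction_on with
    | _ m ih =>
      intro hm
      exact tendsto_nhds_unique
        (tendsto_div_qParam_pow one_pos hper' hhol hbdd fun j hj ↦ ih j hj (hj.trans hm))
        (tendsto_of_tendsto_div_qParam_pow hm hf)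
  exact ⟨h1, tendsto_nhds_unique (tendsto_div_qParam_pow one_pos hper' hhol hbdd h1) hf⟩

lemma valuation_eq_of_tendsto {f : ℍ → ℂ} (hper : Periodic (f ∘ ofComplex) 1)
    (hhol : MDiff f) {n : ℕ} {c : ℂ} (hc : c ≠ 0)
    (hf : Tendsto (fun τ : ℍ ↦ f τ / 𝕢 1 τ ^ n) atImInfty (𝓝 c)) : valuation f = n := by
  obtain ⟨h1, h2⟩ := coeff_of_tendsto_div_qParam_pow hper hhol hf
  exact PowerSeries.order_eq_nat.mpr ⟨h2 ▸ hc, h1⟩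

/-! ### Functions invariant under `Γ₀(N)` -/

lemma mem_Gamma0_iff_dvd {N : ℕ} {g : SL(2, ℤ)} : g ∈ Gamma0 N ↔ (N : ℤ) ∣ g 1 0 := by
  rw [Gamma0_mem, ZMod.intCast_zmod_eq_zero_iff_dvd]

lemma periodic_comp_ofComplex_of_vadd {f : ℍ → ℂ} {h : ℝ} (hf : ∀ τ : ℍ, f (h +ᵥ τ) = f τ) :
    Periodic (f ∘ ofComplex) h := by
  intro w
  by_cases! hw : 0 < w.im
  · have : 0 < (w + h).im := by simp [hw]
    simp only [comp_apply, ofComplex_apply_of_im_pos this, ofComplex_apply_of_im_pos hw]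
    rw [← hf ⟨w, hw⟩]
    congr 1
    ext
    simp [add_comm]
  · have : (w + h).im ≤ 0 := by simpa using hw
    simp [ofComplex_apply_of_im_nonpos this, ofComplex_apply_of_im_nonpos hw]

lemma slash_T_zpow_apply (f : ℍ → ℂ) (k : ℤ) (n : ℤ) (τ : ℍ) :
    (f ∣[k] (ModularGroup.T ^ n)) τ = f ((n : ℝ) +ᵥ τ) := by
  rw [SL_slash_apply, modular_T_zpow_smul, ModularGroup.denom_apply]
  simp [ModularGroup.coe_T_zpow]

/-- A translate of a `Γ₀(N)`-invariant function by an element of `SL(2, ℤ)` has period `N`, because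
`Γ(N)` is normal in `SL(2, ℤ)`. -/
lemma slash_vadd {N : ℕ} {k : ℤ} {f : ℍ → ℂ} (hf : ∀ γ ∈ Gamma0 N, f ∣[k] γ = f) (g : SL(2, ℤ))
    (τ : ℍ) : (f ∣[k] g) ((N : ℝ) +ᵥ τ) = (f ∣[k] g) τ := by
  have hT : ModularGroup.T ^ (N : ℤ) ∈ Gamma N := by
    simpa using ModularGroup_T_pow_mem_Gamma N N dvd_rfl
  have hc := (Gamma_normal (N := N)).conj_mem _ hT g
  have hc0 : g * ModularGroup.T ^ (N : ℤ) * g⁻¹ ∈ Gamma0 N := by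
    rw [Gamma0_mem]
    exact (Gamma_mem.mp hc).2.2.1
  have := slash_T_zpow_apply (f ∣[k] g) k N τ
  rw [Int.cast_natCast] at this
  rw [← this, ← SlashAction.slash_mul]
  conv_rhs => rw [← hf _ hc0, ← SlashAction.slash_mul]
  simp

lemma periodic_slash {N : ℕ} {k : ℤ} {f : ℍ → ℂ} (hf : ∀ γ ∈ Gamma0 N, f ∣[k] γ = f)
    (g : SL(2, ℤ)) : Periodic ((f ∣[k] g) ∘ ofComplex) ((N : ℝ) : ℂ) :=
  periodic_comp_ofComplex_of_vadd (slash_vadd hf g)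

lemma periodic_of_invariant {N : ℕ} {k : ℤ} {f : ℍ → ℂ} (hf : ∀ γ ∈ Gamma0 N, f ∣[k] γ = f) :
    Periodic (f ∘ ofComplex) 1 := by
  have : Periodic (f ∘ ofComplex) ((1 : ℝ) : ℂ) := by
    refine periodic_comp_ofComplex_of_vadd fun τ ↦ ?_
    have := slash_T_zpow_apply f k 1 τ
    rw [Int.cast_one] at this
    rw [← this, hf _ (by simp)]
  simpa using this

lemma exists_SL2Z_of_isCusp_GammaZero {N : ℕ} (hN : 0 < N) {c : OnePoint ℝ}
    (hc : IsCusp c (GammaZero N)) : ∃ g : SL(2, ℤ), c = mapGL ℝ g • OnePoint.infty := by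
  have : NeZero N := ⟨hN.ne'⟩
  rwa [Subgroup.IsArithmetic.isCusp_iff_isCusp_SL2Z, isCusp_SL2Z_iff'] at hc

lemma isCusp_GammaZero {N : ℕ} (hN : 0 < N) (g : SL(2, ℤ)) :
    IsCusp (mapGL ℝ g • OnePoint.infty) (GammaZero N) := by
  have : NeZero N := ⟨hN.ne'⟩
  rw [Subgroup.IsArithmetic.isCusp_iff_isCusp_SL2Z, isCusp_SL2Z_iff']
  exact ⟨g, rfl⟩

lemma slash_eq_of_mem_Gamma0 {N : ℕ} {k : ℤ} {F : Type*} [FunLike F ℍ ℂ]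
    [SlashInvariantFormClass F (GammaZero N) k] (f : F) {γ : SL(2, ℤ)} (hγ : γ ∈ Gamma0 N) :
    (f : ℍ → ℂ) ∣[k] γ = f :=
  SlashInvariantFormClass.slash_action_eq f _ (Subgroup.mem_map_of_mem _ hγ)

/-- A `Γ₀(N)`-invariant holomorphic function is a cusp form if it vanishes at `∞` and at the
cusps `g ∞` with `g` outside `Γ₀(N)`. -/
def cuspFormOfInvariant {N : ℕ} (hN : 0 < N) {k : ℤ} (f : ℍ → ℂ)
    (hf : ∀ γ ∈ Gamma0 N, f ∣[k] γ = f) (hhol : MDiff f) (h0 : IsZeroAtImInfty f)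
    (hc : ∀ g : SL(2, ℤ), g ∉ Gamma0 N → IsZeroAtImInfty (f ∣[k] g)) : CuspForms N k where
  toFun := f
  slash_action_eq' γ hγ := by
    obtain ⟨g, hg, rfl⟩ := Subgroup.mem_map.mp hγ
    exact hf g hg
  holo' := hhol
  zero_at_cusps' {c} hcusp := by
    obtain ⟨g, rfl⟩ := exists_SL2Z_of_isCusp_GammaZero hN hcusp
    rw [OnePoint.isZeroAt_iff rfl]
    by_cases hg : g ∈ Gamma0 N
    · exact (congrArg IsZeroAtImInfty (hf g hg)).mpr h0
    · exact hc g hg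

/-- A `Γ₀(N)`-invariant holomorphic function is a modular form if it is bounded at `∞` and at the
cusps `g ∞` with `g` outside `Γ₀(N)`. -/
def modularFormOfInvariant {N : ℕ} (hN : 0 < N) {k : ℤ} (f : ℍ → ℂ)
    (hf : ∀ γ ∈ Gamma0 N, f ∣[k] γ = f) (hhol : MDiff f) (h0 : IsBoundedAtImInfty f)
    (hc : ∀ g : SL(2, ℤ), g ∉ Gamma0 N → IsBoundedAtImInfty (f ∣[k] g)) : ModForms N k where
  toFun := f
  slash_action_eq' γ hγ := by
    obtain ⟨g, hg, rfl⟩ := Subgroup.mem_map.mp hγ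
    exact hf g hg
  holo' := hhol
  bdd_at_cusps' {c} hcusp := by
    obtain ⟨g, rfl⟩ := exists_SL2Z_of_isCusp_GammaZero hN hcusp
    rw [OnePoint.isBoundedAt_iff rfl]
    by_cases hg : g ∈ Gamma0 N
    · exact (congrArg IsBoundedAtImInfty (hf g hg)).mpr h0
    · exact hc g hg

/-- For `g` in `SL(2, ℤ)`, the cusp `g ∞` is equivalent to `∞` under `Γ₀(N)` only if `g` lies in
`Γ₀(N)`. -/
lemma mem_Gamma0_of_smul_infty_eq {N : ℕ} {g : SL(2, ℤ)} {γ : GL (Fin 2) ℝ} (hγ : γ ∈ GammaZero N)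
    (h : γ • (OnePoint.infty : OnePoint ℝ) = mapGL ℝ g • OnePoint.infty) : g ∈ Gamma0 N := by
  obtain ⟨γ, hγ', rfl⟩ := Subgroup.mem_map.mp hγ
  have h1 : mapGL ℝ (γ⁻¹ * g) • (OnePoint.infty : OnePoint ℝ) = OnePoint.infty := by
    rw [map_mul, mul_smul, ← h, ← mul_smul, ← map_mul]
    simp
  rw [OnePoint.smul_infty_eq_self_iff] at h1
  have h2 : γ⁻¹ * g ∈ Gamma0 N := by
    rw [mem_Gamma0_iff_dvd]
    have : (γ⁻¹ * g) 1 0 = 0 := by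
      simpa [-map_mul] using h1
    simp [this]
  simpa using (Gamma0 N).mul_mem hγ' h2

/-! ### Valuations -/

lemma one_mem_strictPeriods_GammaZero (N : ℕ) : (1 : ℝ) ∈ (GammaZero N).strictPeriods := by simp

instance fact_isCusp_infty_GammaZero (N : ℕ) : Fact (IsCusp OnePoint.infty (GammaZero N)) :=
  ⟨Subgroup.isCusp_of_mem_strictPeriods one_pos (one_mem_strictPeriods_GammaZero N)⟩

/-- The `q`-expansion at `∞` of cusp forms, as a linear map. -/
def cuspQExpansion (N : ℕ) (k : ℤ) : CuspForms N k →ₗ[ℂ] PowerSeries ℂ where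
  toFun f := qExpansion 1 f
  map_add' f g := ModularForm.qExpansion_add one_pos (one_mem_strictPeriods_GammaZero N) f g
  map_smul' a f := ModularForm.qExpansion_smul one_pos (one_mem_strictPeriods_GammaZero N) a f

lemma order_cuspQExpansion {N : ℕ} {k : ℤ} (f : CuspForms N k) :
    (cuspQExpansion N k f).order = valuation f := rfl

lemma cuspQExpansion_injective (N : ℕ) (k : ℤ) : Injective (cuspQExpansion N k) := by
  rw [injective_iff_map_eq_zero]
  intro f hf
  have h1 := one_mem_strictPeriods_GammaZero N
  have := (qExpansion_eq_zero_iff one_pos (SlashInvariantFormClass.periodic_comp_ofComplex f h1)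
    (ModularFormClass.holo f) (ModularFormClass.bdd_at_infty f)).mp hf
  exact DFunLike.coe_injective this

lemma one_le_valuation {N : ℕ} {k : ℤ} (f : CuspForms N k) : 1 ≤ valuation f := by
  refine PowerSeries.nat_le_order _ 1 fun i hi ↦ ?_
  obtain rfl : i = 0 := by omega
  exact CuspFormClass.qExpansion_coeff_zero f one_pos (one_mem_strictPeriods_GammaZero N)

lemma qExpansion_mulCusp {N : ℕ} {ρ : ℤ} (D : ModForms N ρ) (k : ℤ) (f : CuspForms N k) :
    qExpansion 1 (mulCusp D k f) = qExpansion 1 D * qExpansion 1 f :=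
  ModularForm.qExpansion_mul_coe one_pos (one_mem_strictPeriods_GammaZero N) D f

lemma valuation_mulCusp {N : ℕ} {ρ : ℤ} (D : ModForms N ρ) (k : ℤ) (f : CuspForms N k) :
    valuation (mulCusp D k f) = valuation D + valuation f := by
  rw [valuation, qExpansion_mulCusp, PowerSeries.order_mul]
  rfl

lemma IsUnitary.mulCusp {N : ℕ} {ρ : ℤ} {D : ModForms N ρ} {k : ℤ} {f : CuspForms N k}
    (hD : IsUnitary D) (hf : IsUnitary f) : IsUnitary (mulCusp D k f) := by
  obtain ⟨n, hn, hn'⟩ := hD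
  obtain ⟨m, hm, hm'⟩ := hf
  refine ⟨n + m, by rw [valuation_mulCusp, hn, hm, Nat.cast_add], ?_⟩
  rw [qExpansion_mulCusp, PowerSeries.coeff_mul, Finset.sum_eq_single (n, m), hn', hm', one_mul]
  · rintro ⟨a, b⟩ hab hne
    replace hab : a + b = n + m := Finset.HasAntidiagonal.mem_antidiagonal.mp hab
    by_cases ha : a < n
    · rw [PowerSeries.coeff_of_lt_order a (by rw [← valuation, hn]; exact_mod_cast ha), zero_mul]
    · have hb : b < m := by
        by_contra hb
        exact hne (Prod.ext (by simp only; omega) (by simp only; omega))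
      rw [PowerSeries.coeff_of_lt_order b (by rw [← valuation, hm]; exact_mod_cast hb), mul_zero]
  · simp

lemma tendsto_div_qParam_pow_modForms {N : ℕ} {ρ : ℤ} {F : Type*} [FunLike F ℍ ℂ]
    [ModularFormClass F (GammaZero N) ρ] (D : F) {n : ℕ} (hn : n ≤ valuation D) :
    Tendsto (fun τ : ℍ ↦ D τ / 𝕢 1 τ ^ n) atImInfty (𝓝 ((qExpansion 1 D).coeff n)) := by
  have h1 := one_mem_strictPeriods_GammaZero N
  exact tendsto_div_qParam_pow one_pos (SlashInvariantFormClass.periodic_comp_ofComplex D h1)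
    (ModularFormClass.holo D) (ModularFormClass.bdd_at_infty D) fun m hm ↦
      PowerSeries.coeff_of_lt_order m (lt_of_lt_of_le (by exact_mod_cast hm) hn)

/-! ### Division by a strong modular form -/

namespace IsStrongModularForm

variable {N : ℕ} {ρ : ℤ} {D : ModForms N ρ}

/-- At the cusps not equivalent to `∞`, a strong modular form has a nonzero limit. -/
lemma exists_tendsto_slash (hD : IsStrongModularForm D) (hN : 0 < N) {g : SL(2, ℤ)}
    (hg : g ∉ Gamma0 N) : ∃ c : ℂ, c ≠ 0 ∧ Tendsto ((D : ℍ → ℂ) ∣[ρ] g) atImInfty (𝓝 c) := by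
  have hbdd : IsBoundedAtImInfty ((D : ℍ → ℂ) ∣[ρ] g) :=
    ModularFormClass.bdd_at_cusps D (isCusp_GammaZero hN g) _ rfl
  have ht := tendsto_valueAtInfty (Nat.cast_pos.mpr hN)
    (periodic_slash (fun γ hγ ↦ slash_eq_of_mem_Gamma0 D hγ) g)
    ((ModularFormClass.holo D).slash ρ _) hbdd
  refine ⟨_, fun h0 ↦ ?_, ht⟩
  refine hD.not_isZeroAt (mapGL ℝ g • OnePoint.infty) (isCusp_GammaZero hN g)
    (fun γ hγ h ↦ hg (mem_Gamma0_of_smul_infty_eq hγ h)) ((OnePoint.isZeroAt_iff rfl).mpr ?_)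
  rw [h0] at ht
  exact ht

lemma mulCusp_injective (hD : IsStrongModularForm D) (k : ℤ) : Injective (mulCusp D k) := by
  rw [injective_iff_map_eq_zero]
  intro f hf
  ext τ
  have := DFunLike.congr_fun hf τ
  simpa [hD.ne_zero τ] using this

/-- The quotient `Φ / D` is holomorphic as `D` has no zeros, vanishes at `∞` as `ν(D) < ν(Φ)`, and
vanishes at the other cusps as `Φ` does and `D` has nonzero limits there. -/
lemma exists_mulCusp_eq (hD : IsStrongModularForm D) (hN : 0 < N) {k : ℤ}
    {Φ : CuspForms N (k + ρ)} (hΦ : valuation D < valuation Φ) :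
    ∃ f : CuspForms N k, mulCusp D k f = Φ := by
  have hslash (g : SL(2, ℤ)) : ((Φ : ℍ → ℂ) / D) ∣[k] g =
      ((Φ : ℍ → ℂ) ∣[k + ρ] g) / ((D : ℍ → ℂ) ∣[ρ] g) := by
    simpa using div_slash_SL2 (k + ρ) ρ g Φ D
  refine ⟨cuspFormOfInvariant hN ((Φ : ℍ → ℂ) / D) ?_ ?_ ?_ ?_, ?_⟩
  · intro γ hγ
    rw [hslash, slash_eq_of_mem_Gamma0 Φ hγ, slash_eq_of_mem_Gamma0 D hγ]
  · rw [UpperHalfPlane.mdifferentiable_iff]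
    exact (UpperHalfPlane.mdifferentiable_iff.mp (ModularFormClass.holo Φ)).div
      (UpperHalfPlane.mdifferentiable_iff.mp (ModularFormClass.holo D)) fun z _ ↦ hD.ne_zero _
  · obtain ⟨n, hn, hn'⟩ := hD.isUnitary
    rw [hn] at hΦ
    have h1 := tendsto_div_qParam_pow_modForms Φ hΦ.le
    have h2 := tendsto_div_qParam_pow_modForms D hn.ge
    rw [hn'] at h2
    rw [PowerSeries.coeff_of_lt_order n hΦ] at h1
    have := h1.div h2 one_ne_zero
    rw [zero_div] at this
    refine this.congr fun τ ↦ ?_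
    have hq : 𝕢 1 τ ≠ 0 := Periodic.qParam_ne_zero _
    have := hD.ne_zero τ
    simp only [Pi.div_apply]
    field_simp
  · intro g hg
    obtain ⟨c, hc, ht⟩ := hD.exists_tendsto_slash hN hg
    have h1 : Tendsto ((Φ : ℍ → ℂ) ∣[k + ρ] g) atImInfty (𝓝 0) :=
      CuspFormClass.zero_at_cusps Φ (isCusp_GammaZero hN g) _ rfl
    rw [hslash]
    have := h1.div ht hc
    rwa [zero_div] at this
  · ext τ
    exact mul_div_cancel₀ (Φ τ) (hD.ne_zero τ)

lemma mem_range_mulCusp_iff (hD : IsStrongModularForm D) (hN : 0 < N) {k : ℤ}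
    (Φ : CuspForms N (k + ρ)) :
    Φ ∈ LinearMap.range (mulCusp D k) ↔ valuation D < valuation Φ := by
  refine ⟨?_, fun h ↦ hD.exists_mulCusp_eq hN h⟩
  rintro ⟨f, rfl⟩
  obtain ⟨n, hn, -⟩ := hD.isUnitary
  rw [valuation_mulCusp, hn]
  calc (n : ℕ∞) < n + 1 := by exact_mod_cast n.lt_succ_self
    _ ≤ n + valuation f := by gcongr; exact one_le_valuation f

/-! ### Finite dimensionality -/

lemma finiteDimensional_add (hD : IsStrongModularForm D) (hN : 0 < N) {k : ℤ}
    (hk : FiniteDimensional ℂ (CuspForms N k)) : FiniteDimensional ℂ (CuspForms N (k + ρ)) := by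
  obtain ⟨n, hn, -⟩ := hD.isUnitary
  -- the coefficients of degree at most `ν(D)`; their common zeros are divisible by `D`
  let L : CuspForms N (k + ρ) →ₗ[ℂ] (Fin (n + 1) → ℂ) :=
    LinearMap.pi fun i ↦ (PowerSeries.coeff (R := ℂ) i) ∘ₗ cuspQExpansion N (k + ρ)
  have hker : LinearMap.ker L ≤ LinearMap.range (mulCusp D k) := by
    intro Φ hΦ
    rw [hD.mem_range_mulCusp_iff hN, hn]
    refine lt_of_lt_of_le (b := ((n + 1 : ℕ) : ℕ∞)) (by exact_mod_cast n.lt_succ_self) ?_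
    exact PowerSeries.nat_le_order _ _ fun i hi ↦ congrFun hΦ ⟨i, hi⟩
  have h1 : FiniteDimensional ℂ (LinearMap.ker L) := Submodule.finiteDimensional_of_le hker
  have h2 : FiniteDimensional ℂ (CuspForms N (k + ρ) ⧸ LinearMap.ker L) :=
    Module.Finite.equiv L.quotKerEquivRange.symm
  exact Module.Finite.of_submodule_quotient (LinearMap.ker L)

end IsStrongModularForm

lemma CuspForm.eq_zero_of_nonpos_weight {N : ℕ} (hN : 0 < N) {k : ℤ} (hk : k ≤ 0)
    (f : CuspForms N k) : f = 0 := by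
  have : NeZero N := ⟨hN.ne'⟩
  rcases hk.lt_or_eq with hk | rfl
  · have := ModularForm.isZero_of_neg_weight hk (ModularFormClass.modularForm f)
    ext τ
    exact DFunLike.congr_fun this τ
  · obtain ⟨c, hc⟩ := ModularForm.eq_const_of_weight_zero (ModularFormClass.modularForm f)
    have hf : (f : ℍ → ℂ) = Function.const ℍ c := hc
    have h0 : IsZeroAtImInfty f := CuspFormClass.zero_at_infty f
    rw [hf] at h0
    have : c = 0 := tendsto_nhds_unique tendsto_const_nhds h0
    ext τ
    rw [hf, this]
    rfl

/-- `S_k(Γ₀(N))` is finite dimensional: division by a strong modular form of weight `ρ > 0` lowers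
the weight by `ρ` at the cost of finitely many `q`-coefficients, and there are no cusp forms of
weight `≤ 0`. -/
lemma IsStrongModularForm.finiteDimensional {N : ℕ} (hN : 0 < N) {ρ : ℤ} {D : ModForms N ρ}
    (hD : IsStrongModularForm D) (hρ : 0 < ρ) (k : ℤ) : FiniteDimensional ℂ (CuspForms N k) := by
  have key : ∀ n : ℕ, ∀ k ≤ n * ρ, FiniteDimensional ℂ (CuspForms N k) := by
    intro n
    induction n with
    | zero =>
      intro k hk
      have : Subsingleton (CuspForms N k) := subsingleton_of_forall_eq 0
        (CuspForm.eq_zero_of_nonpos_weight hN (by simpa using hk))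
      infer_instance
    | succ n ih =>
      intro k hk
      have := hD.finiteDimensional_add hN (ih (k - ρ) (by push_cast at hk; linarith))
      rwa [sub_add_cancel] at this
  refine key k.toNat k ((Int.self_le_toNat k).trans ?_)
  exact le_mul_of_one_le_right (by positivity) hρ

/-! ### Triangular bases -/

section Triangular

variable {K V ι : Type*} [Field K] [AddCommGroup V] [Module K V] (φ : V →ₗ[K] PowerSeries K)

/-- In a linear combination of vectors with strictly increasing orders, the vectors of order
smaller than that of the sum do not occur. -/
lemma coeff_eq_zero_of_order_lt [LinearOrder ι] [Fintype ι] {b : ι → V}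
    (hb : StrictMono fun i ↦ (φ (b i)).order) (c : ι → K) (i : ι)
    (hi : (φ (b i)).order < (φ (∑ j, c j • b j)).order) : c i = 0 := by
  induction i using WellFoundedLT.induction with
  | _ i ih =>
    obtain ⟨n, hn⟩ := ENat.ne_top_iff_exists.mp hi.ne_top
    have h1 : (φ (∑ j, c j • b j)).coeff n = 0 :=
      PowerSeries.coeff_of_lt_order n (by rw [hn]; exact hi)
    rw [map_sum, map_sum, Finset.sum_eq_single i] at h1
    · simp only [map_smul, smul_eq_mul, mul_eq_zero] at h1
      exact h1.resolve_right (PowerSeries.order_eq_nat.mp hn.symm).1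
    · intro j _ hj
      rcases hj.lt_or_gt with hj | hj
      · simp [ih j hj ((hb hj).trans hi)]
      · have : (φ (b j)).coeff n = 0 :=
          PowerSeries.coeff_of_lt_order n (by rw [hn]; exact hb hj)
        simp [this]
    · simp

lemma linearIndependent_of_strictMono_order [LinearOrder ι] [Fintype ι] {b : ι → V}
    (hb : StrictMono fun i ↦ (φ (b i)).order) (hb' : ∀ i, (φ (b i)).order ≠ ⊤) :
    LinearIndependent K b := by
  rw [Fintype.linearIndependent_iff]
  intro c hc i
  refine coeff_eq_zero_of_order_lt φ hb c i ?_
  rw [hc, map_zero, PowerSeries.order_zero]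
  exact (hb' i).lt_top

lemma exists_basis_of_strictMono_order [FiniteDimensional K V] {d : ℕ}
    (hd : d = Module.finrank K V) {b : Fin d → V}
    (hb : StrictMono fun i ↦ (φ (b i)).order) (hb' : ∀ i, (φ (b i)).order ≠ ⊤) :
    ∃ B : Module.Basis (Fin d) K V, ⇑B = b := by
  subst hd
  rcases isEmpty_or_nonempty (Fin (Module.finrank K V)) with h | h
  · have : Subsingleton V := by
      rw [← Module.finrank_eq_zero_iff_of_free K V]
      rwa [← not_nonempty_iff, ← Fin.pos_iff_nonempty, Nat.pos_iff_ne_zero, not_not] at h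
    exact ⟨Module.Basis.empty V, funext fun i ↦ h.elim i⟩
  · exact ⟨basisOfLinearIndependentOfCardEqFinrank
      (linearIndependent_of_strictMono_order φ hb hb') (by simp),
      coe_basisOfLinearIndependentOfCardEqFinrank _ _⟩

/-- The order of a nonzero vector is the order of one of the members of a triangular basis. -/
lemma exists_order_basis_eq [LinearOrder ι] [Fintype ι] {B : Module.Basis ι K V}
    (hB : StrictMono fun i ↦ (φ (B i)).order) {f : V} {n : ℕ} (hf : (φ f).order = n) :
    ∃ i, (φ (B i)).order = n := by
  by_contra! h
  have h1 := (PowerSeries.order_eq_nat.mp hf).1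
  rw [← B.sum_repr f, map_sum, map_sum] at h1
  refine h1 (Finset.sum_eq_zero fun i _ ↦ ?_)
  rcases (h i).lt_or_gt with hi | hi
  · rw [coeff_eq_zero_of_order_lt φ hB (B.repr f) i (by rw [B.sum_repr, hf]; exact hi)]
    simp
  · rw [map_smul, map_smul, PowerSeries.coeff_of_lt_order n hi, smul_zero]

variable [FiniteDimensional K V]

/-- The set `O` of the orders of nonzero vectors has as many elements as the dimension. -/
lemma exists_finset_order_card_eq_finrank (hφ : Injective φ) :
    ∃ O : Finset ℕ, (∀ n, n ∈ O ↔ ∃ f, (φ f).order = n) ∧ O.card = Module.finrank K V := by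
  have hle (t : Finset ℕ) (ht : ∀ n ∈ t, ∃ f, (φ f).order = n) :
      t.card ≤ Module.finrank K V := by
    choose! f hf using ht
    have hord (n : t) : (φ (f n)).order = (n : ℕ) := hf n n.2
    have : LinearIndependent K fun n : t ↦ f n := by
      refine linearIndependent_of_strictMono_order φ (fun m n hmn ↦ ?_) fun n ↦ ?_
      · simp only [hord]
        exact_mod_cast hmn
      · simp [hord]
    simpa using this.fintype_card_le_finrank
  have hfin : {n : ℕ | ∃ f, (φ f).order = n}.Finite := by
    by_contra hinf
    obtain ⟨t, ht, hcard⟩ := Set.Infinite.exists_subset_card_eq hinf (Module.finrank K V + 1)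
    have := hle t fun n hn ↦ ht hn
    omega
  refine ⟨hfin.toFinset, fun n ↦ by simp, le_antisymm (hle _ fun n hn ↦ by simpa using hn) ?_⟩
  -- the coefficients indexed by the possible orders separate the vectors
  let L : V →ₗ[K] (hfin.toFinset → K) := LinearMap.pi fun n ↦ PowerSeries.coeff (n : ℕ) ∘ₗ φ
  have hL : Injective L := by
    rw [injective_iff_map_eq_zero]
    intro f hf
    by_contra hne
    have hne' : φ f ≠ 0 := fun h ↦ hne (hφ (by rw [h, map_zero]))
    obtain ⟨n, hn⟩ := ENat.ne_top_iff_exists.mp fun h ↦ hne' (PowerSeries.order_eq_top.mp h)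
    exact (PowerSeries.order_eq_nat.mp hn.symm).1
      (congrFun hf ⟨n, by simpa using ⟨f, hn.symm⟩⟩)
  simpa using LinearMap.finrank_le_finrank_of_injective hL

lemma exists_strictMono_order (hφ : Injective φ) {d : ℕ} (hd : d = Module.finrank K V) :
    ∃ b : Fin d → V, (StrictMono fun i ↦ (φ (b i)).order) ∧
      ∀ i, ∃ n : ℕ, (φ (b i)).order = n ∧ (φ (b i)).coeff n = 1 := by
  obtain ⟨O, hO, hcard⟩ := exists_finset_order_card_eq_finrank φ hφ
  have hex (n : O) : ∃ f, (φ f).order = (n : ℕ) ∧ (φ f).coeff n = 1 := by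
    obtain ⟨f, hf⟩ := (hO n).mp n.2
    have hf' := PowerSeries.order_eq_nat.mp hf
    refine ⟨((φ f).coeff n)⁻¹ • f, PowerSeries.order_eq_nat.mpr ⟨?_, fun i hi ↦ ?_⟩, ?_⟩
    · simp [hf'.1]
    · simp [hf'.2 i hi]
    · simp [hf'.1]
  choose f hf using hex
  let e := O.orderIsoOfFin (hcard.trans hd.symm)
  refine ⟨fun i ↦ f (e i), fun i j hij ↦ ?_, fun i ↦ ⟨_, hf (e i)⟩⟩
  simp only [(hf _).1]
  exact_mod_cast e.strictMono hij

end Triangular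

lemma Fin.val_lt_card_iff_of_antitone {d : ℕ} {P : Fin d → Prop} (hP : ∀ i j, i ≤ j → P j → P i)
    (i : Fin d) : (i : ℕ) < Nat.card {j // P j} ↔ P i := by
  classical
  have e : Nat.card {j // P j} = (Finset.univ.filter P).card := by
    rw [Nat.card_eq_fintype_card, Fintype.card_subtype]
  rw [e]
  constructor
  · intro h
    by_contra hi
    have : Finset.univ.filter P ⊆ Finset.Iio i := fun j hj ↦ by
      rw [Finset.mem_Iio]
      by_contra hij
      exact hi (hP i j (not_lt.mp hij) (Finset.mem_filter.mp hj).2)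
    have := Finset.card_le_card this
    rw [Fin.card_Iio] at this
    omega
  · intro h
    have : Finset.Iic i ⊆ Finset.univ.filter P := fun j hj ↦ by
      simpa using hP j i (Finset.mem_Iic.mp hj) h
    have := Finset.card_le_card this
    rw [Fin.card_Iic] at this
    omega

namespace IsUnitaryUpperTriangular

variable {N : ℕ} {k : ℤ} {G : Module.Basis (Fin (cuspDim N k)) ℂ (CuspForms N k)}

lemma repr_eq_zero (hG : IsUnitaryUpperTriangular G) (f : CuspForms N k) {i : Fin (cuspDim N k)}
    (hi : valuation (G i) < valuation f) : G.repr f i = 0 := by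
  refine coeff_eq_zero_of_order_lt (cuspQExpansion N k) hG.strictMono (G.repr f) i ?_
  rw [G.sum_repr]
  exact hi

lemma exists_valuation_eq (hG : IsUnitaryUpperTriangular G) {f : CuspForms N k} {n : ℕ}
    (hf : valuation f = n) : ∃ i, valuation (G i) = n :=
  exists_order_basis_eq (cuspQExpansion N k) hG.strictMono hf

lemma lt_card_iff (hG : IsUnitaryUpperTriangular G) (v : ℕ∞) (i : Fin (cuspDim N k)) :
    (i : ℕ) < Nat.card {j // valuation (G j) ≤ v} ↔ valuation (G i) ≤ v :=
  Fin.val_lt_card_iff_of_antitone (fun _ _ hij h ↦ (hG.strictMono.monotone hij).trans h) i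

/-- If `1, …, n` all are valuations of cusp forms, then exactly `n` members of a triangular basis
have valuation at most `n`. -/
lemma card_valuation_le (hG : IsUnitaryUpperTriangular G) {n : ℕ}
    (h : ∀ t : ℕ, 1 ≤ t → t ≤ n → ∃ f : CuspForms N k, valuation f = t) :
    Nat.card {j // valuation (G j) ≤ n} = n := by
  have hval (j) : ∃ l : ℕ, valuation (G j) = l := (hG.isUnitary j).imp fun _ h ↦ h.1
  choose l hl using hval
  have hinj : Injective l := fun i j hij ↦ hG.strictMono.injective (by simp only [hl, hij])
  have : Set.image l {j | valuation (G j) ≤ n} = (Finset.Icc 1 n : Set ℕ) := by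
    ext t
    simp only [Set.mem_image, Set.mem_ofPred_eq, Finset.coe_Icc, Set.mem_Icc]
    constructor
    · rintro ⟨j, hj, rfl⟩
      have h1 := one_le_valuation (G j)
      rw [hl] at hj h1
      exact ⟨by exact_mod_cast h1, by exact_mod_cast hj⟩
    · rintro ⟨h1, h2⟩
      obtain ⟨f, hf⟩ := h t h1 h2
      obtain ⟨i, hi⟩ := hG.exists_valuation_eq hf
      refine ⟨i, by rw [hi]; exact_mod_cast h2, ?_⟩
      rw [hl] at hi
      exact_mod_cast hi
  calc Nat.card {j // valuation (G j) ≤ n} = Set.ncard {j | valuation (G j) ≤ n} := rfl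
    _ = (Finset.Icc 1 n : Set ℕ).ncard := by
      rw [← this, Set.ncard_image_of_injective _ hinj]
    _ = n := by rw [Set.ncard_coe_finset]; simp

end IsUnitaryUpperTriangular

lemma exists_isUnitaryUpperTriangular {N : ℕ} {k : ℤ} [FiniteDimensional ℂ (CuspForms N k)] :
    ∃ F : Module.Basis (Fin (cuspDim N k)) ℂ (CuspForms N k), IsUnitaryUpperTriangular F := by
  obtain ⟨b, hb, hb'⟩ := exists_strictMono_order (cuspQExpansion N k)
    (cuspQExpansion_injective N k) (d := cuspDim N k) rfl
  obtain ⟨B, rfl⟩ := exists_basis_of_strictMono_order (cuspQExpansion N k)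
    (d := cuspDim N k) rfl hb fun i ↦ by
    obtain ⟨n, hn, -⟩ := hb' i
    simp [hn]
  exact ⟨B, hb', hb⟩

namespace IsStrongModularForm

variable {N : ℕ} {ρ : ℤ} {D : ModForms N ρ}

lemma isCompl_range_mulCusp (hD : IsStrongModularForm D) (hN : 0 < N) {k : ℤ}
    {G : Module.Basis (Fin (cuspDim N (k + ρ))) ℂ (CuspForms N (k + ρ))}
    (hG : IsUnitaryUpperTriangular G) :
    IsCompl (Submodule.span ℂ {f | ∃ i, f = G i ∧ valuation (G i) ≤ valuation D})
      (LinearMap.range (mulCusp D k)) := by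
  have himage : {f | ∃ i, f = G i ∧ valuation (G i) ≤ valuation D} =
      G '' {i | valuation (G i) ≤ valuation D} := by
    ext f
    simp only [Set.mem_ofPred_eq, Set.mem_image]
    exact ⟨fun ⟨i, h1, h2⟩ ↦ ⟨i, h2, h1.symm⟩, fun ⟨i, h1, h2⟩ ↦ ⟨i, h2.symm, h1⟩⟩
  rw [himage]
  constructor
  · rw [Submodule.disjoint_def]
    intro f hf hf'
    rw [Module.Basis.mem_span_image] at hf
    rw [hD.mem_range_mulCusp_iff hN] at hf'
    rw [← G.repr.map_eq_zero_iff]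
    ext i
    by_contra hi
    exact hi (hG.repr_eq_zero f (lt_of_le_of_lt (hf (Finsupp.mem_support_iff.mpr hi)) hf'))
  · rw [codisjoint_iff, eq_top_iff, ← G.span_eq, Submodule.span_le]
    rintro _ ⟨i, rfl⟩
    rcases le_or_gt (valuation (G i)) (valuation D) with hi | hi
    · exact Submodule.mem_sup_left (Submodule.subset_span ⟨i, hi, rfl⟩)
    · exact Submodule.mem_sup_right ((hD.mem_range_mulCusp_iff hN _).mpr hi)

lemma cuspDim_add (hD : IsStrongModularForm D) (hN : 0 < N) {k : ℤ}
    [FiniteDimensional ℂ (CuspForms N (k + ρ))]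
    {G : Module.Basis (Fin (cuspDim N (k + ρ))) ℂ (CuspForms N (k + ρ))}
    (hG : IsUnitaryUpperTriangular G) :
    cuspDim N (k + ρ) = Nat.card {j // valuation (G j) ≤ valuation D} + cuspDim N k := by
  have h1 := Submodule.finrank_add_eq_of_isCompl (hD.isCompl_range_mulCusp hN hG)
  rw [LinearMap.finrank_range_of_inj (hD.mulCusp_injective k)] at h1
  have h2 : {f | ∃ i, f = G i ∧ valuation (G i) ≤ valuation D} =
      Set.range fun j : {j // valuation (G j) ≤ valuation D} ↦ G j := by
    ext f
    simp only [Set.mem_ofPred_eq, Set.mem_range, Subtype.exists]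
    exact ⟨fun ⟨i, h1, h2⟩ ↦ ⟨i, h2, h1.symm⟩, fun ⟨i, h1, h2⟩ ↦ ⟨i, h2.symm, h1⟩⟩
  classical
  have h3 := finrank_span_eq_card (G.linearIndependent.comp
    (Subtype.val : {j // valuation (G j) ≤ valuation D} → _) Subtype.val_injective)
  rw [← Nat.card_eq_fintype_card] at h3
  rw [h2] at h1
  exact h1.symm.trans (congrArg (· + cuspDim N k) h3)

/-- A triangular basis of `S_k(Γ₀(N))` is multiplied by `D` and completed by the members of small
valuation of any triangular basis of `S_{k+ρ}(Γ₀(N))`. -/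
lemma exists_isUnitaryUpperTriangular_extending (hD : IsStrongModularForm D) (hN : 0 < N) {k : ℤ}
    [FiniteDimensional ℂ (CuspForms N (k + ρ))]
    {F : Module.Basis (Fin (cuspDim N k)) ℂ (CuspForms N k)} (hF : IsUnitaryUpperTriangular F) :
    ∃ G : Module.Basis (Fin (cuspDim N (k + ρ))) ℂ (CuspForms N (k + ρ)),
      IsUnitaryUpperTriangular G ∧ ∀ i : Fin (cuspDim N (k + ρ)),
        Nat.card {j // valuation (G j) ≤ valuation D} ≤ (i : ℕ) →
        ∃ j : Fin (cuspDim N k),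
          (i : ℕ) = Nat.card {j // valuation (G j) ≤ valuation D} + j ∧
          G i = mulCusp D k (F j) := by
  obtain ⟨n, hn, -⟩ := hD.isUnitary
  obtain ⟨H, hH⟩ := exists_isUnitaryUpperTriangular (N := N) (k := k + ρ)
  have hdim := hD.cuspDim_add hN hH
  have hlt := hH.lt_card_iff (valuation D)
  generalize Nat.card {j // valuation (H j) ≤ valuation D} = m at hdim hlt
  let b : Fin (cuspDim N (k + ρ)) → CuspForms N (k + ρ) := fun i ↦
    if h : (i : ℕ) < m then H i else mulCusp D k (F ⟨i - m, by omega⟩)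
  have hb1 (i : Fin (cuspDim N (k + ρ))) (hi : (i : ℕ) < m) : b i = H i := dif_pos hi
  have hb2 (i : Fin (cuspDim N (k + ρ))) (hi : ¬ (i : ℕ) < m) :
      b i = mulCusp D k (F ⟨i - m, by omega⟩) := dif_neg hi
  have hle (i) : valuation (b i) ≤ valuation D ↔ (i : ℕ) < m := by
    by_cases hi : (i : ℕ) < m
    · rw [hb1 i hi]
      simp only [hi, iff_true]
      exact (hlt i).mp hi
    · rw [hb2 i hi]
      simp only [hi, iff_false, not_le]
      exact (hD.mem_range_mulCusp_iff hN _).mp ⟨_, rfl⟩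
  have hunit (i) : IsUnitary (b i) := by
    by_cases hi : (i : ℕ) < m
    · rw [hb1 i hi]
      exact hH.isUnitary i
    · rw [hb2 i hi]
      exact hD.isUnitary.mulCusp (hF.isUnitary _)
  have hmono : StrictMono fun i ↦ valuation (b i) := by
    intro i j hij
    have hij' : (i : ℕ) < j := hij
    simp only
    by_cases hi : (i : ℕ) < m
    · by_cases hj : (j : ℕ) < m
      · rw [hb1 i hi, hb1 j hj]
        exact hH.strictMono hij
      · exact ((hle i).mpr hi).trans_lt (not_le.mp ((hle j).not.mpr hj))
    · have hj : ¬ (j : ℕ) < m := by omega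
      rw [hb2 i hi, hb2 j hj, valuation_mulCusp, valuation_mulCusp, hn]
      refine (ENat.add_lt_add_iff_left (ENat.natCast_ne_top n)).mpr (hF.strictMono ?_)
      simp only [Fin.mk_lt_mk]
      omega
  obtain ⟨G, hG⟩ := exists_basis_of_strictMono_order (cuspQExpansion N (k + ρ))
    (d := cuspDim N (k + ρ)) rfl hmono
    fun i ↦ by
      obtain ⟨l, hl, -⟩ := hunit i
      simp [order_cuspQExpansion, hl]
  have hGb (i) : G i = b i := congrFun hG i
  have hGtri : IsUnitaryUpperTriangular G := by
    constructor
    · intro i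
      rw [hGb]
      exact hunit i
    · simp only [hGb]
      exact hmono
  have hm : Nat.card {j // valuation (G j) ≤ valuation D} = m := by
    have := hD.cuspDim_add hN hGtri
    omega
  refine ⟨G, hGtri, fun i hi ↦ ?_⟩
  rw [hm] at hi ⊢
  exact ⟨⟨i - m, by omega⟩, by simp only; omega, by rw [hGb, hb2 i (by omega)]⟩

end IsStrongModularForm

/-! ### Poincaré series with poles at `∞` -/

/-- The function `q ^ (-j)` on the upper half plane. -/
def invQPow (j : ℕ) (τ : ℍ) : ℂ := (𝕢 1 τ ^ j)⁻¹

lemma invQPow_vadd (j : ℕ) (n : ℤ) (τ : ℍ) : invQPow j ((n : ℝ) +ᵥ τ) = invQPow j τ := by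
  have : 𝕢 1 ((n : ℂ) + τ) = 𝕢 1 τ := by
    have h : Complex.exp (2 * Real.pi * Complex.I * n / (1 : ℝ)) = 1 := by
      rw [← Complex.exp_int_mul_two_pi_mul_I n]
      congr 1
      push_cast
      ring
    rw [Periodic.qParam, Periodic.qParam, mul_add, add_div, Complex.exp_add, h, one_mul]
  simp [invQPow, this]

lemma norm_invQPow (j : ℕ) (τ : ℍ) : ‖invQPow j τ‖ = Real.exp (2 * Real.pi * j * τ.im) := by
  rw [invQPow, norm_inv, norm_pow, Periodic.norm_qParam, ← Real.exp_nat_mul, ← Real.exp_neg]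
  congr 1
  simp
  ring

lemma mdifferentiable_invQPow (j : ℕ) : MDiff (invQPow j) := by
  rw [UpperHalfPlane.mdifferentiable_iff]
  have : DifferentiableOn ℂ (fun z : ℂ ↦ (𝕢 1 z ^ j)⁻¹) {z | 0 < z.im} := by
    intro z _
    exact ((Periodic.differentiable_qParam.differentiableAt.pow j).inv
      (pow_ne_zero j (Periodic.qParam_ne_zero z))).differentiableWithinAt
  exact this.congr fun z hz ↦ by simp [invQPow, ofComplex_apply_of_im_pos hz]

/-- Matrices with the same bottom row differ by a translation on the left, which leaves `q ^ (-j)`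
invariant. -/
lemma invQPow_slash_eq_of_row_eq (j : ℕ) (w : ℤ) {γ γ' : SL(2, ℤ)} (h : γ 1 = γ' 1) :
    invQPow j ∣[w] γ = invQPow j ∣[w] γ' := by
  have h0 : (γ * γ'⁻¹) 1 0 = 0 := by
    have h1 := congrFun h 0
    have h2 := congrFun h 1
    simp [Matrix.SpecialLinearGroup.coe_inv, Matrix.adjugate_fin_two, Matrix.mul_apply,
      Fin.sum_univ_two, h1, h2]
    ring
  obtain ⟨n, hn⟩ := ModularGroup.exists_eq_T_zpow_of_c_eq_zero h0
  ext τ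
  have e : γ • τ = (n : ℝ) +ᵥ (γ' • τ) := by
    rw [← modular_T_zpow_smul, ← hn, ← mul_smul]
    simp
  rw [SL_slash_apply, SL_slash_apply, e, invQPow_vadd, ModularGroup.denom_apply,
    ModularGroup.denom_apply, h]

open Classical in
/-- The summand of the Poincaré series attached to the bottom row `v = (c, d)`: the translate of
`q ^ (-j)` in weight `w` by any matrix of `SL(2, ℤ)` with bottom row `v`. -/
def poincareTerm (w : ℤ) (j : ℕ) (v : Fin 2 → ℤ) : ℍ → ℂ :=
  if h : ∃ γ : SL(2, ℤ), γ 1 = v then invQPow j ∣[w] h.choose else 0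

lemma poincareTerm_row (w : ℤ) (j : ℕ) (γ : SL(2, ℤ)) :
    poincareTerm w j (γ 1) = invQPow j ∣[w] γ := by
  have h : ∃ γ' : SL(2, ℤ), γ' 1 = γ 1 := ⟨γ, rfl⟩
  rw [poincareTerm, dif_pos h]
  exact invQPow_slash_eq_of_row_eq j w h.choose_spec

/-- The bottom rows of the matrices in the coset `Γ₀(N) g`. -/
def cosetRows (N : ℕ) (g : SL(2, ℤ)) : Set (Fin 2 → ℤ) :=
  {v | ∃ γ : SL(2, ℤ), γ * g⁻¹ ∈ Gamma0 N ∧ γ 1 = v}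

/-- The Poincaré series of weight `w` with leading term `q ^ (-j)`, summed over the bottom rows of
the coset `Γ₀(N) g`. For `g = 1` it is the series for `Γ₀(N)` (counted twice, as `±γ` both occur);
in general it is the translate of that one by `g`. -/
def poincareSeries (N : ℕ) (w : ℤ) (j : ℕ) (g : SL(2, ℤ)) (τ : ℍ) : ℂ :=
  ∑' v : cosetRows N g, poincareTerm w j v τ

lemma cosetRows_of_mem {N : ℕ} {γ : SL(2, ℤ)} (hγ : γ ∈ Gamma0 N) :
    cosetRows N γ = cosetRows N 1 := by
  ext v
  simp only [cosetRows, Set.mem_ofPred_eq, inv_one, mul_one]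
  refine exists_congr fun γ' ↦ and_congr_left fun _ ↦ ?_
  exact Subgroup.mul_mem_cancel_right _ (inv_mem hγ)

lemma vecMul_mem_cosetRows {N : ℕ} {h : SL(2, ℤ)} (g : SL(2, ℤ)) {v : Fin 2 → ℤ}
    (hv : v ∈ cosetRows N h) : Matrix.vecMul v g.1 ∈ cosetRows N (h * g) := by
  obtain ⟨γ, hγ, rfl⟩ := hv
  refine ⟨γ * g, by simpa [mul_assoc] using hγ, ?_⟩
  rw [Matrix.SpecialLinearGroup.coe_mul, Matrix.mul_apply_eq_vecMul]

lemma vecMul_vecMul_inv (g : SL(2, ℤ)) (v : Fin 2 → ℤ) :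
    Matrix.vecMul (Matrix.vecMul v g.1) (g⁻¹ : SL(2, ℤ)).1 = v := by
  rw [Matrix.vecMul_vecMul, ← Matrix.SpecialLinearGroup.coe_mul]
  simp

/-- Right multiplication by `g` identifies the bottom rows of `Γ₀(N)` with those of `Γ₀(N) g`. -/
def cosetRowsEquiv (N : ℕ) (g : SL(2, ℤ)) : cosetRows N 1 ≃ cosetRows N g where
  toFun v := ⟨Matrix.vecMul v.1 g.1, by simpa using vecMul_mem_cosetRows g v.2⟩
  invFun v := ⟨Matrix.vecMul v.1 (g⁻¹ : SL(2, ℤ)).1, by simpa using vecMul_mem_cosetRows g⁻¹ v.2⟩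
  left_inv v := Subtype.ext (vecMul_vecMul_inv g v)
  right_inv v := Subtype.ext (by simpa using vecMul_vecMul_inv g⁻¹ v)

lemma poincareSeries_slash (N : ℕ) (w : ℤ) (j : ℕ) (g : SL(2, ℤ)) :
    poincareSeries N w j 1 ∣[w] g = poincareSeries N w j g := by
  ext τ
  rw [SL_slash_apply, poincareSeries, poincareSeries, ← tsum_mul_right,
    ← (cosetRowsEquiv N g).tsum_eq]
  refine tsum_congr fun ⟨v, γ, _, hv⟩ ↦ ?_
  simp only [cosetRowsEquiv, Equiv.coe_fn_mk]
  rw [← SL_slash_apply]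
  subst hv
  rw [← Matrix.mul_apply_eq_vecMul, ← Matrix.SpecialLinearGroup.coe_mul, poincareTerm_row,
    poincareTerm_row, SlashAction.slash_mul]

lemma poincareSeries_invariant (N : ℕ) (w : ℤ) (j : ℕ) {γ : SL(2, ℤ)} (hγ : γ ∈ Gamma0 N) :
    poincareSeries N w j 1 ∣[w] γ = poincareSeries N w j 1 := by
  rw [poincareSeries_slash]
  ext τ
  rw [poincareSeries, poincareSeries, cosetRows_of_mem hγ]

/-! ### Convergence of the Poincaré series -/

lemma im_smul_le_inv_im {γ : SL(2, ℤ)} (hγ : γ 1 0 ≠ 0) (τ : ℍ) : (γ • τ).im ≤ 1 / τ.im := by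
  rw [ModularGroup.im_smul_eq_div_normSq, ModularGroup.denom_apply, Complex.normSq_apply,
    div_le_div_iff₀ _ τ.im_pos]
  · have h1 : (1 : ℝ) ≤ (γ 1 0 : ℝ) ^ 2 := by
      exact_mod_cast Int.add_one_le_iff.mpr (sq_pos_iff.mpr hγ)
    have h2 := sq_nonneg ((γ 1 0 : ℝ) * τ.re + γ 1 1)
    have h3 : 0 < τ.im ^ 2 := pow_pos τ.im_pos 2
    simp
    nlinarith
  · rw [← Complex.normSq_apply, ← ModularGroup.denom_apply]
    exact Complex.normSq_pos.mpr (denom_ne_zero _ _)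

lemma sq_eq_one_of_row_zero {γ : SL(2, ℤ)} (hγ : γ 1 0 = 0) : γ 1 1 ^ 2 = 1 := by
  have h := Matrix.det_fin_two γ.1
  rw [γ.2, hγ, mul_zero, sub_zero] at h
  have := Int.isUnit_iff.mp (IsUnit.of_mul_eq_one_right _ h.symm)
  rcases this with h | h <;> rw [h] <;> norm_num

lemma im_smul_eq_im {γ : SL(2, ℤ)} (hγ : γ 1 0 = 0) (τ : ℍ) : (γ • τ).im = τ.im := by
  have h : (γ 1 1 : ℝ) ^ 2 = 1 := by exact_mod_cast sq_eq_one_of_row_zero hγ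
  rw [ModularGroup.im_smul_eq_div_normSq, ModularGroup.denom_apply, Complex.normSq_apply, hγ]
  simp [← sq, h]

lemma norm_slash_invQPow (w : ℤ) (j : ℕ) (γ : SL(2, ℤ)) (τ : ℍ) :
    ‖(invQPow j ∣[w] γ) τ‖ = Real.exp (2 * Real.pi * j * (γ • τ).im) *
      ‖(γ 1 0 : ℂ) * τ + γ 1 1‖ ^ (-(w : ℝ)) := by
  rw [SL_slash_apply, norm_mul, norm_invQPow, norm_zpow, ModularGroup.denom_apply,
    ← Real.rpow_intCast]
  push_cast
  rfl

/-- The summands are those of an Eisenstein series times `q ^ (-j)` at `γτ`, which is bounded as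
long as the imaginary part of `γτ` is; this is `≤ 1 / Im τ` for `c ≠ 0`, and `Im τ` for `c = 0`. -/
lemma norm_poincareTerm_le {N : ℕ} {g : SL(2, ℤ)} (w : ℤ) (hw : 0 ≤ w) (j : ℕ) {A B C : ℝ}
    (hB : 0 < B) {v : Fin 2 → ℤ} (hv : v ∈ cosetRows N g) {τ : ℍ} (hτ : τ ∈ verticalStrip A B)
    (hC : v 0 = 0 → τ.im ≤ C) (hC' : 1 / B ≤ C) :
    ‖poincareTerm w j v τ‖ ≤ Real.exp (2 * Real.pi * j * C) *
      (EisensteinSeries.r ⟨⟨A, B⟩, hB⟩ ^ (-(w : ℝ)) * ‖v‖ ^ (-(w : ℝ))) := by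
  obtain ⟨γ, -, rfl⟩ := hv
  have him : (γ • τ).im ≤ C := by
    by_cases h : γ 1 0 = 0
    · rw [im_smul_eq_im h]
      exact hC h
    · exact (im_smul_le_inv_im h τ).trans ((one_div_le_one_div_of_le hB hτ.2).trans hC')
  rw [poincareTerm_row, norm_slash_invQPow]
  gcongr
  exact EisensteinSeries.summand_bound_of_mem_verticalStrip (by exact_mod_cast hw) _ hB hτ

lemma summable_poincare_bound {w : ℤ} (hw : 3 ≤ w) (c r : ℝ) (S : Set (Fin 2 → ℤ)) :
    Summable fun v : S ↦ c * (r * ‖(v : Fin 2 → ℤ)‖ ^ (-(w : ℝ))) := by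
  have hw' : (2 : ℝ) < w := by exact_mod_cast hw
  exact (((EisensteinSeries.summable_one_div_norm_rpow hw').subtype S).mul_left r).mul_left c

lemma mdifferentiable_poincareTerm {N : ℕ} {g : SL(2, ℤ)} (w : ℤ) (j : ℕ) {v : Fin 2 → ℤ}
    (hv : v ∈ cosetRows N g) : MDiff (poincareTerm w j v) := by
  obtain ⟨γ, -, rfl⟩ := hv
  rw [poincareTerm_row]
  exact (mdifferentiable_invQPow j).slash w _

lemma mdifferentiable_poincareSeries (N : ℕ) {w : ℤ} (hw : 3 ≤ w) (j : ℕ) (g : SL(2, ℤ)) :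
    MDiff (poincareSeries N w j g) := by
  intro τ
  rw [UpperHalfPlane.mdifferentiableAt_iff]
  -- near `τ` the summands are uniformly bounded by a summable family
  let B := τ.im / 2
  have hB : 0 < B := half_pos τ.im_pos
  let A := |τ.re| + 1
  let C := max (τ.im + 1) (1 / B)
  let U : Set ℂ := {z | |z.re| < A ∧ B < z.im ∧ z.im < τ.im + 1}
  have hU : IsOpen U :=
    (isOpen_lt (continuous_abs.comp Complex.continuous_re) continuous_const).inter
      ((isOpen_lt continuous_const Complex.continuous_im).inter
        (isOpen_lt Complex.continuous_im continuous_const))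
  have hτU : (τ : ℂ) ∈ U := ⟨by simp [A], by simpa [B] using half_lt_self τ.im_pos, by simp⟩
  refine DifferentiableOn.differentiableAt (s := U) ?_ (hU.mem_nhds hτU)
  refine Complex.differentiableOn_tsum_of_summable_norm
    (F := fun (v : cosetRows N g) (z : ℂ) ↦ (poincareTerm w j v ∘ ofComplex) z)
    (summable_poincare_bound hw (Real.exp (2 * Real.pi * j * C))
      (EisensteinSeries.r ⟨⟨A, B⟩, hB⟩ ^ (-(w : ℝ))) _) (fun v ↦ ?_) hU fun v z hz ↦ ?_
  · exact (UpperHalfPlane.mdifferentiable_iff.mp (mdifferentiable_poincareTerm w j v.2)).mono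
      fun z hz ↦ hB.trans hz.2.1
  · have hz0 : 0 < z.im := hB.trans hz.2.1
    rw [comp_apply, ofComplex_apply_of_im_pos hz0]
    refine norm_poincareTerm_le w (by omega) j hB v.2 ⟨hz.1.le, hz.2.1.le⟩ (fun _ ↦ ?_)
      (le_max_right _ _)
    exact hz.2.2.le.trans (le_max_left _ _)

/-! ### Poincaré series at the cusps -/

/-- A limit at `i∞` of a periodic function may be computed in a vertical strip. -/
lemma tendsto_atImInfty_of_tendsto_strip {f : ℍ → ℂ} {N : ℝ} (hN : 0 < N)
    (hper : Periodic (f ∘ ofComplex) (N : ℂ)) {c : ℂ}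
    (hf : Tendsto f (atImInfty ⊓ 𝓟 {τ | |τ.re| ≤ N}) (𝓝 c)) : Tendsto f atImInfty (𝓝 c) := by
  intro s hs
  obtain ⟨A, hA⟩ := (atImInfty_mem _).mp (mem_inf_principal.mp (hf hs))
  refine (atImInfty_mem _).mpr ⟨A, fun τ hτ ↦ ?_⟩
  let n := ⌊τ.re / N⌋
  have h0 : 0 < ((τ : ℂ) - n * N).im := by simpa using τ.im_pos
  have h1 := hper.sub_int_mul_eq (x := (τ : ℂ)) n
  rw [comp_apply, comp_apply, ofComplex_apply_of_im_pos h0, ofComplex_apply] at h1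
  rw [Set.mem_preimage, ← h1]
  refine hA _ (by simpa using hτ) ?_
  have h2 : τ.re / N * N = τ.re := div_mul_cancel₀ _ hN.ne'
  have h3 := mul_le_mul_of_nonneg_right (Int.floor_le (τ.re / N)) hN.le
  have h4 := mul_lt_mul_of_pos_right (Int.lt_floor_add_one (τ.re / N)) hN
  rw [h2] at h3 h4
  have h5 : (⟨(τ : ℂ) - n * N, h0⟩ : ℍ).re = τ.re - n * N := by
    change ((τ : ℂ) - n * N).re = _
    simp
  simp only [Set.mem_ofPred_eq]
  rw [h5, abs_le]
  constructor <;> simp only [n] <;> linarith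

lemma tendsto_poincareTerm {N : ℕ} {g : SL(2, ℤ)} {w : ℤ} (hw : 0 < w) (j : ℕ) {v : Fin 2 → ℤ}
    (hv : v ∈ cosetRows N g) (hv0 : v 0 ≠ 0) :
    Tendsto (poincareTerm w j v) atImInfty (𝓝 0) := by
  obtain ⟨γ, -, rfl⟩ := hv
  rw [poincareTerm_row]
  have hlim : Tendsto (fun τ : ℍ ↦ Real.exp (2 * Real.pi * j) * τ.im ^ (-(w : ℝ)))
      atImInfty (𝓝 0) := by
    have := (tendsto_rpow_neg_atTop (y := (w : ℝ)) (by exact_mod_cast hw)).const_mul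
      (Real.exp (2 * Real.pi * j))
    rw [mul_zero] at this
    exact this.comp tendsto_comap
  refine squeeze_zero_norm' ?_ hlim
  filter_upwards [(atImInfty_mem {τ | 1 ≤ τ.im}).mpr ⟨1, fun z hz ↦ hz⟩] with τ hτ
  have hτ : 1 ≤ τ.im := hτ
  rw [norm_slash_invQPow]
  gcongr ?_ * ?_
  · have h1 := im_smul_le_inv_im hv0 τ
    have h2 : (γ • τ).im ≤ 1 := h1.trans (by rw [div_le_one τ.im_pos]; exact hτ)
    calc Real.exp (2 * Real.pi * j * (γ • τ).im) ≤ Real.exp (2 * Real.pi * j * 1) := by gcongr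
      _ = _ := by rw [mul_one]
  · refine Real.rpow_le_rpow_of_nonpos τ.im_pos ?_ (by simpa using hw.le)
    calc τ.im ≤ |(γ 1 0 : ℝ)| * τ.im := le_mul_of_one_le_left τ.im_pos.le
          (by exact_mod_cast Int.one_le_abs hv0)
      _ = |((γ 1 0 : ℂ) * τ + γ 1 1).im| := by simp [abs_mul, abs_of_pos τ.im_pos]
      _ ≤ _ := Complex.abs_im_le_norm _

lemma row_zero_ne_zero {N : ℕ} {g : SL(2, ℤ)} (hg : g ∉ Gamma0 N) {v : Fin 2 → ℤ}
    (hv : v ∈ cosetRows N g) : v 0 ≠ 0 := by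
  obtain ⟨γ, hγ, rfl⟩ := hv
  intro h
  have h1 : γ ∈ Gamma0 N := by
    rw [mem_Gamma0_iff_dvd, h]
    exact dvd_zero _
  have := mul_mem (inv_mem hγ) h1
  simp at this
  exact hg this

lemma eventually_mem_verticalStrip (A : ℝ) :
    ∀ᶠ τ in atImInfty ⊓ 𝓟 {τ : ℍ | |τ.re| ≤ A}, τ ∈ verticalStrip A 1 := by
  filter_upwards [mem_inf_of_left ((atImInfty_mem {τ | 1 ≤ τ.im}).mpr ⟨1, fun z hz ↦ hz⟩),
    mem_inf_of_right (mem_principal_self _)] with τ h1 h2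
  exact ⟨h2, h1⟩

/-- The Poincaré series vanishes at the cusps that are not equivalent to `∞`. -/
lemma isZeroAtImInfty_poincareSeries {N : ℕ} (hN : 0 < N) {w : ℤ} (hw : 3 ≤ w) (j : ℕ)
    {g : SL(2, ℤ)} (hg : g ∉ Gamma0 N) : IsZeroAtImInfty (poincareSeries N w j g) := by
  have hper : Periodic (poincareSeries N w j g ∘ ofComplex) ((N : ℝ) : ℂ) := by
    rw [← poincareSeries_slash]
    exact periodic_slash (fun γ hγ ↦ poincareSeries_invariant N w j hγ) g
  refine tendsto_atImInfty_of_tendsto_strip (Nat.cast_pos.mpr hN) hper ?_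
  rw [show (0 : ℂ) = ∑' _ : cosetRows N g, (0 : ℂ) by simp]
  refine tendsto_tsum_of_dominated_convergence (summable_poincare_bound hw
    (Real.exp (2 * Real.pi * j * 1)) (EisensteinSeries.r ⟨⟨N, 1⟩, one_pos⟩ ^ (-(w : ℝ))) _)
    (fun v ↦ (tendsto_poincareTerm (by omega) j v.2 (row_zero_ne_zero hg v.2)).mono_left
      inf_le_left) ?_
  filter_upwards [eventually_mem_verticalStrip N] with τ hτ v
  exact norm_poincareTerm_le w (by omega) j one_pos v.2 hτ
    (fun h ↦ absurd h (row_zero_ne_zero hg v.2)) (by norm_num)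

/-- At `∞` the Poincaré series of even weight behaves like a multiple of `q ^ (-j)`. -/
lemma exists_tendsto_poincareSeries (N : ℕ) {w : ℤ} (hw : 3 ≤ w) (hw' : Even w) (j : ℕ) :
    ∃ c : ℂ, c ≠ 0 ∧
      Tendsto (fun τ : ℍ ↦ 𝕢 1 τ ^ j * poincareSeries N w j 1 τ) atImInfty (𝓝 c) := by
  classical
  have hper : Periodic ((fun τ : ℍ ↦ 𝕢 1 τ ^ j * poincareSeries N w j 1 τ) ∘ ofComplex)
      ((1 : ℝ) : ℂ) := by
    have h1 := periodic_of_invariant fun γ hγ ↦ poincareSeries_invariant N w j (γ := γ) hγ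
    refine periodic_comp_ofComplex_of_vadd fun τ ↦ ?_
    have h2 := h1 τ
    have h3 := invQPow_vadd j 1 τ
    rw [Int.cast_one] at h3
    rw [invQPow, invQPow, inv_inj] at h3
    rw [h3]
    congr 1
    rw [comp_apply, comp_apply, ofComplex_apply] at h2
    rw [← h2, ← ofComplex_apply ((1 : ℝ) +ᵥ τ)]
    congr 2
    simp [add_comm]
  have hzero {v : Fin 2 → ℤ} (hv : v ∈ cosetRows N 1) (hv0 : v 0 = 0) (τ : ℍ) :
      𝕢 1 τ ^ j * poincareTerm w j v τ = 1 := by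
    obtain ⟨γ, -, rfl⟩ := hv
    obtain ⟨n, hn⟩ := ModularGroup.exists_eq_T_zpow_of_c_eq_zero hv0
    rw [poincareTerm_row, SL_slash_apply, hn, modular_T_zpow_smul, invQPow_vadd, invQPow,
      ModularGroup.denom_apply, hv0]
    have h1 : ((γ 1 1 : ℤ) : ℂ) ^ w = 1 := by
      obtain ⟨l, rfl⟩ := hw'
      rw [← two_mul, zpow_mul]
      have : ((γ 1 1 : ℤ) : ℂ) ^ (2 : ℤ) = 1 := by exact_mod_cast sq_eq_one_of_row_zero hv0
      rw [this, one_zpow]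
    have hq : 𝕢 1 τ ≠ 0 := Periodic.qParam_ne_zero _
    simp [h1, hq]
  have hnorm (τ : ℍ) : ‖𝕢 1 τ ^ j‖ ≤ 1 := by
    rw [norm_pow]
    exact pow_le_one₀ (norm_nonneg _) (Periodic.norm_qParam_lt_one one_pos τ.im_pos).le
  have hone : (![0, 1] : Fin 2 → ℤ) ∈ cosetRows N 1 := by
    refine ⟨1, by simp, ?_⟩
    ext i
    fin_cases i <;> simp
  -- the rows with `c = 0` contribute `1` each to the limit, all others contribute `0`
  let χ : cosetRows N 1 → ℝ := fun v ↦ if v.1 0 = 0 then 1 else 0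
  let bound : cosetRows N 1 → ℝ := fun v ↦ Real.exp (2 * Real.pi * j * 1) *
    (EisensteinSeries.r ⟨⟨1, 1⟩, one_pos⟩ ^ (-(w : ℝ)) * ‖(v : Fin 2 → ℤ)‖ ^ (-(w : ℝ)))
  have hbound : Summable bound := summable_poincare_bound hw _ _ _
  have hχ : Summable χ := by
    refine summable_of_hasFiniteSupport (Set.Finite.subset
      (s := {v : cosetRows N 1 | v.1 ∈ ({![0, 1], ![0, -1]} : Set (Fin 2 → ℤ))})
      ((Set.toFinite _).preimage Subtype.val_injective.injOn) ?_)
    rintro ⟨_, γ, _, rfl⟩ hv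
    have hv0 : γ 1 0 = 0 := by
      by_contra h
      exact hv (if_neg h)
    rcases sq_eq_one_iff.mp (sq_eq_one_of_row_zero hv0) with h | h
    · left
      ext i
      fin_cases i
      exacts [hv0, h]
    · right
      ext i
      fin_cases i
      exacts [hv0, h]
  refine ⟨((∑' v, χ v : ℝ) : ℂ), ?_, ?_⟩
  · rw [Complex.ofReal_ne_zero]
    refine (hχ.tsum_pos (fun v ↦ ?_) ⟨_, hone⟩ (by simp [χ])).ne'
    simp only [χ]
    split_ifs <;> norm_num
  refine tendsto_atImInfty_of_tendsto_strip one_pos hper ?_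
  simp only [poincareSeries, ← tsum_mul_left, Complex.ofReal_tsum]
  refine tendsto_tsum_of_dominated_convergence (hχ.add hbound) (fun v ↦ ?_) ?_
  · by_cases hv0 : v.1 0 = 0
    · simp only [hzero v.2 hv0, χ, hv0, if_true, Complex.ofReal_one]
      exact tendsto_const_nhds
    · simp only [χ, hv0, if_false, Complex.ofReal_zero]
      have h0 := tendsto_zero_iff_norm_tendsto_zero.mp
        (tendsto_poincareTerm (show 0 < w by omega) j v.2 hv0)
      refine squeeze_zero_norm (fun τ ↦ ?_) (h0.mono_left inf_le_left)
      rw [norm_mul]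
      exact mul_le_of_le_one_left (norm_nonneg _) (hnorm τ)
  · filter_upwards [eventually_mem_verticalStrip 1] with τ hτ v
    have hb : 0 ≤ bound v := mul_nonneg (Real.exp_pos _).le
      (mul_nonneg (Real.rpow_nonneg (EisensteinSeries.r_pos _).le _)
        (Real.rpow_nonneg (norm_nonneg _) _))
    by_cases hv0 : v.1 0 = 0
    · rw [hzero v.2 hv0, norm_one]
      simp only [χ, hv0, if_true]
      linarith
    · simp only [χ, hv0, if_false, zero_add]
      rw [norm_mul]
      refine (mul_le_of_le_one_left (norm_nonneg _) (hnorm τ)).trans ?_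
      exact norm_poincareTerm_le w (by omega) j one_pos v.2 hτ (fun h ↦ absurd h hv0)
        (by norm_num)

/-- In weight `w + ρ` with `w ≥ 4` even there are cusp forms of every valuation `1, …, ν(D)`: the
products of `D` with the Poincaré series of weight `w` having a pole of order `< ν(D)` at `∞`. -/
lemma exists_cuspForm_valuation_eq {N : ℕ} {ρ : ℤ} {D : ModForms N ρ} (hN : 0 < N)
    {w : ℤ} (hw : 3 ≤ w) (hw' : Even w) {n : ℕ}
    (hn : valuation D = n) {t : ℕ} (h1 : 1 ≤ t) (ht : t ≤ n) :
    ∃ f : CuspForms N (w + ρ), valuation f = t := by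
  obtain ⟨c, hc, hlim⟩ := exists_tendsto_poincareSeries N hw hw' (n - t)
  have hD1 := tendsto_div_qParam_pow_modForms D hn.ge
  set P := poincareSeries N w (n - t) 1 with hP
  have hlim' : Tendsto (fun τ : ℍ ↦ (P * (D : ℍ → ℂ)) τ / 𝕢 1 τ ^ t) atImInfty
      (𝓝 (c * (qExpansion 1 D).coeff n)) := by
    refine (hlim.mul hD1).congr fun τ ↦ ?_
    have hq : 𝕢 1 τ ≠ 0 := Periodic.qParam_ne_zero _
    have e : 𝕢 1 τ ^ n = 𝕢 1 τ ^ (n - t) * 𝕢 1 τ ^ t := by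
      rw [← pow_add, Nat.sub_add_cancel ht]
    rw [e, Pi.mul_apply]
    field_simp
  have hslash (g : SL(2, ℤ)) : (P * (D : ℍ → ℂ)) ∣[w + ρ] g =
      poincareSeries N w (n - t) g * ((D : ℍ → ℂ) ∣[ρ] g) := by
    rw [mul_slash_SL2, hP, poincareSeries_slash]
  have hinv (γ : SL(2, ℤ)) (hγ : γ ∈ Gamma0 N) :
      (P * (D : ℍ → ℂ)) ∣[w + ρ] γ = P * (D : ℍ → ℂ) := by
    rw [mul_slash_SL2, hP, poincareSeries_invariant N w _ hγ, slash_eq_of_mem_Gamma0 D hγ]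
  have hhol : MDiff (P * (D : ℍ → ℂ)) :=
    (mdifferentiable_poincareSeries N hw (n - t) 1).mul (ModularFormClass.holo D)
  have h0 : IsZeroAtImInfty (P * (D : ℍ → ℂ)) := by
    have := tendsto_of_tendsto_div_qParam_pow h1 hlim'
    simp only [pow_zero, div_one] at this
    exact this
  refine ⟨cuspFormOfInvariant hN (P * (D : ℍ → ℂ)) hinv hhol h0 fun g hg ↦ ?_, ?_⟩
  · rw [hslash]
    exact Filter.ZeroAtFilter.mul_boundedAtFilter (isZeroAtImInfty_poincareSeries hN hw _ hg)
      (ModularFormClass.bdd_at_cusps D (isCusp_GammaZero hN g) _ rfl)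
  · exact valuation_eq_of_tendsto (periodic_of_invariant hinv) hhol
      (mul_ne_zero hc (PowerSeries.order_eq_nat.mp hn).1) hlim'

/-! ### Möbius sums -/

open ArithmeticFunction in
/-- Jordan's totient `J₂(n) = n ^ 2 ∏ (1 - p⁻²)`, over the primes dividing `n`, is positive. -/
lemma sum_moebius_mul_sq_pos {n : ℕ} (hn : 0 < n) :
    0 < ∑ x ∈ n.divisorsAntidiagonal, moebius x.1 * (x.2 : ℤ) ^ 2 := by
  let J : ArithmeticFunction ℤ := moebius * ((pow 2 : ArithmeticFunction ℕ) : ArithmeticFunction ℤ)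
  have hJ (n : ℕ) : J n = ∑ x ∈ n.divisorsAntidiagonal, moebius x.1 * (x.2 : ℤ) ^ 2 := by
    simp [J, ArithmeticFunction.mul_apply, pow_apply]
  have hsum : ∀ n : ℕ, n > 0 → ∑ i ∈ n.divisors, J i = (n : ℤ) ^ 2 :=
    sum_eq_iff_sum_mul_moebius_eq.mpr fun n _ ↦ by simp [hJ]
  have hmul : J.IsMultiplicative :=
    isMultiplicative_moebius.mul isMultiplicative_pow.natCast
  rw [← hJ]
  induction n using Nat.recOnPosPrimePosCoprime with
  | prime_pow p k hp hk =>
    obtain ⟨k, rfl⟩ := Nat.exists_eq_succ_of_ne_zero hk.ne'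
    have h1 := hsum (p ^ (k + 1)) (pow_pos hp.pos _)
    have h2 := hsum (p ^ k) (pow_pos hp.pos _)
    rw [Nat.sum_divisors_prime_pow hp] at h1 h2
    rw [Finset.sum_range_succ, h2] at h1
    have h3 : (p ^ k) ^ 2 < (p ^ (k + 1)) ^ 2 :=
      Nat.pow_lt_pow_left (Nat.pow_lt_pow_right hp.one_lt k.lt_succ_self) two_ne_zero
    have h4 : ((p ^ k : ℕ) : ℤ) ^ 2 < ((p ^ (k + 1) : ℕ) : ℤ) ^ 2 := by exact_mod_cast h3
    rw [Nat.succ_eq_add_one]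
    linarith
  | zero => omega
  | one => rw [hmul.map_one]; exact one_pos
  | coprime a b ha hb hab iha ihb =>
    rw [hmul.map_mul_of_coprime hab]
    exact mul_pos (iha (by omega)) (ihb (by omega))

open ArithmeticFunction in
/-- Möbius inversion of `gcd(n, c) ^ 2 = ∑ J₂(i)`, the sum being over the `i` dividing `n` and `c`:
the value at `n` is `J₂(n)` if `n` divides `c`, and zero otherwise. -/
lemma sum_moebius_mul_gcd_sq_eq_zero {n c : ℕ} (hn : 0 < n) (hc : ¬ n ∣ c) :
    ∑ x ∈ n.divisorsAntidiagonal, moebius x.1 * (x.2.gcd c : ℤ) ^ 2 = 0 := by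
  let J : ℕ → ℤ := fun n ↦ ∑ x ∈ n.divisorsAntidiagonal, moebius x.1 * (x.2 : ℤ) ^ 2
  have hsum : ∀ n : ℕ, n > 0 → ∑ i ∈ n.divisors, J i = (n : ℤ) ^ 2 :=
    sum_eq_iff_sum_mul_moebius_eq.mpr fun n _ ↦ by simp [J]
  have h : ∀ n : ℕ, n > 0 → ∑ i ∈ n.divisors, (if i ∣ c then J i else 0) = (n.gcd c : ℤ) ^ 2 := by
    intro n hn
    rw [← hsum _ (Nat.gcd_pos_of_pos_left c hn), ← Finset.sum_filter]
    refine Finset.sum_congr ?_ fun _ _ ↦ rfl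
    ext i
    simp only [Finset.mem_filter, Nat.mem_divisors, Nat.dvd_gcd_iff]
    have := Nat.gcd_pos_of_pos_left c hn
    exact ⟨fun h ↦ ⟨⟨h.1.1, h.2⟩, this.ne'⟩, fun h ↦ ⟨⟨h.1.1, hn.ne'⟩, h.1.2⟩⟩
  have := sum_eq_iff_sum_mul_moebius_eq.mp h n hn
  rw [if_neg hc] at this
  simpa using this

open ArithmeticFunction in
lemma sum_moebius_mul_eq_totient {n : ℕ} (hn : 0 < n) :
    ∑ x ∈ n.divisorsAntidiagonal, (x.2 : ℤ) * moebius x.1 = n.totient := by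
  have h : ∀ n : ℕ, n > 0 → ∑ i ∈ n.divisors, (i.totient : ℤ) = n := fun n _ ↦ by
    exact_mod_cast n.sum_totient
  have := sum_eq_iff_sum_mul_moebius_eq.mp h n hn
  rw [← this]
  exact Finset.sum_congr rfl fun x _ ↦ by simp [mul_comm]

lemma prod_zpow_eq_zpow_sum {ι G : Type*} [CommGroupWithZero G] (s : Finset ι) (a : ι → ℤ) {x : G}
    (hx : x ≠ 0) : ∏ i ∈ s, x ^ a i = x ^ ∑ i ∈ s, a i := by
  classical
  induction s using Finset.induction_on with
  | empty => simp
  | insert i s hi ih => rw [Finset.prod_insert hi, Finset.sum_insert hi, ih, zpow_add₀ hx]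

/-! ### The functions `Δ(dτ)` -/

/-- The matrix with rows `(a, b)` and `(0, e)`. -/
def upperTriangularGL (a b e : ℝ) (h : 0 < a * e) : GL (Fin 2) ℝ :=
  Matrix.GeneralLinearGroup.mkOfDetNeZero !![a, b; 0, e] (by simpa using h.ne')

lemma det_upperTriangularGL {a b e : ℝ} (h : 0 < a * e) :
    (upperTriangularGL a b e h).det.val = a * e := by
  simp [upperTriangularGL, Matrix.GeneralLinearGroup.mkOfDetNeZero]

lemma slash_upperTriangularGL_apply {a b e : ℝ} (h : 0 < a * e) (f : ℍ → ℂ) (k : ℤ) (τ : ℍ) :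
    (f ∣[k] upperTriangularGL a b e h) τ =
      f (upperTriangularGL a b e h • τ) * (((a * e) ^ (k - 1) * e ^ (-k) : ℝ) : ℂ) := by
  have hdet := det_upperTriangularGL (b := b) h
  have hσ : σ (upperTriangularGL a b e h) = ContinuousAlgEquiv.refl ℝ ℂ := by
    rw [σ, if_pos (by rw [hdet]; exact h)]
  rw [slash_apply, hdet, hσ, abs_of_pos h]
  simp [denom, upperTriangularGL, Matrix.GeneralLinearGroup.mkOfDetNeZero, mul_assoc]

lemma coe_upperTriangularGL_smul {a b e : ℝ} (h : 0 < a * e) (τ : ℍ) :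
    ((upperTriangularGL a b e h • τ : ℍ) : ℂ) = (a * τ + b) / e := by
  rw [UpperHalfPlane.coe_smul_of_det_pos (by rw [det_upperTriangularGL]; exact h)]
  simp [num, denom, upperTriangularGL, Matrix.GeneralLinearGroup.mkOfDetNeZero]

lemma tendsto_upperTriangularGL_smul {a b e : ℝ} (h : 0 < a * e) :
    Tendsto (fun τ : ℍ ↦ upperTriangularGL a b e h • τ) atImInfty atImInfty :=
  tendsto_smul_atImInfty (by simp [upperTriangularGL, Matrix.GeneralLinearGroup.mkOfDetNeZero])

/-- Hermite normal form: `diag(d, 1) g` is an element of `SL(2, ℤ)` times an upper triangular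
matrix with diagonal `a = gcd(d, g₁₀)` and `d / a`. -/
lemma exists_diag_mul_eq {d : ℕ} (hd : 0 < d) (g : SL(2, ℤ)) :
    ∃ (γ : SL(2, ℤ)) (b : ℤ) (e : ℕ), d.gcd (g 1 0).natAbs * e = d ∧
      !![(d : ℤ), 0; 0, 1] * g.1 = γ.1 * !![((d.gcd (g 1 0).natAbs : ℕ) : ℤ), b; 0, (e : ℤ)] := by
  set a := d.gcd (g 1 0).natAbs with ha
  have ha0 : 0 < a := Nat.gcd_pos_of_pos_left _ hd
  obtain ⟨e, he⟩ : a ∣ d := Nat.gcd_dvd_left _ _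
  obtain ⟨c, hc⟩ : (a : ℤ) ∣ g 1 0 := Int.natCast_dvd.mpr (Nat.gcd_dvd_right _ _)
  have hdet : g 0 0 * g 1 1 - g 0 1 * g 1 0 = 1 := by
    rw [← Matrix.det_fin_two]
    exact g.2
  have hec : IsCoprime (e : ℤ) c := by
    rw [Int.isCoprime_iff_gcd_eq_one]
    have h1 : Int.gcd (a * e : ℤ) (a * c) = a := by
      rw [← hc, ← Nat.cast_mul, ← he]
      exact ha.symm
    rw [Int.gcd_mul_left, Int.natAbs_natCast] at h1
    exact Nat.eq_of_mul_eq_mul_left ha0 (by rw [h1, mul_one])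
  have hα : IsCoprime (g 0 0) c := by
    refine ⟨g 1 1, - g 0 1 * a, ?_⟩
    rw [hc] at hdet
    linear_combination hdet
  -- `x` and `y` complete the column `(e g₀₀, c)` to a matrix of determinant `1`
  obtain ⟨x, y, hxy⟩ := hec.mul_left hα
  have hdZ : (d : ℤ) = a * e := by exact_mod_cast he
  refine ⟨⟨!![e * g 0 0, -y; c, x], ?_⟩, x * d * g 0 1 + y * g 1 1, e, he.symm, ?_⟩
  · rw [Matrix.det_fin_two_of]
    linear_combination hxy
  · ext i j
    fin_cases i <;> fin_cases j <;> simp [Matrix.mul_apply, Fin.sum_univ_two]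
    · rw [hdZ]; ring
    · rw [hc] at hdet
      rw [hdZ]
      linear_combination (-(a : ℤ) * e * g 0 1) * hxy - e * y * hdet
    · rw [hc]; ring
    · rw [hc] at hdet
      rw [hdZ]
      linear_combination (-g 1 1) * hxy + x * e * hdet

/-- The function `d ^ 11 * Δ(dτ)`: the translate of `Δ` by `diag(d, 1)` in weight `12`. -/
def scaledDiscriminant (d : ℕ) (hd : 0 < d) : ℍ → ℂ :=
  ModularForm.discriminant ∣[(12 : ℤ)] upperTriangularGL d 0 1 (by simpa using hd)

lemma discriminant_slash (γ : SL(2, ℤ)) :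
    ModularForm.discriminant ∣[(12 : ℤ)] γ = ModularForm.discriminant :=
  CuspForm.discriminant.slash_action_eq' _ ⟨γ, rfl⟩

lemma scaledDiscriminant_slash {d : ℕ} (hd : 0 < d) (g : SL(2, ℤ)) :
    ∃ (b : ℤ) (e : ℕ) (he : d.gcd (g 1 0).natAbs * e = d),
      scaledDiscriminant d hd ∣[(12 : ℤ)] g = ModularForm.discriminant ∣[(12 : ℤ)]
        upperTriangularGL (d.gcd (g 1 0).natAbs : ℕ) b e
          (by rw [← Nat.cast_mul, he]; exact_mod_cast hd) := by
  obtain ⟨γ, b, e, he, h⟩ := exists_diag_mul_eq hd g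
  refine ⟨b, e, he, ?_⟩
  have hM : upperTriangularGL d 0 1 (by simpa using hd) * (g : GL (Fin 2) ℝ) = (γ : GL (Fin 2) ℝ) *
      upperTriangularGL (d.gcd (g 1 0).natAbs : ℕ) b e
          (by rw [← Nat.cast_mul, he]; exact_mod_cast hd) := by
    ext i j
    have hij := congrArg (Int.cast (R := ℝ)) (congrFun (congrFun h i) j)
    fin_cases i <;> fin_cases j <;>
    simpa [Matrix.mul_apply, Fin.sum_univ_two, upperTriangularGL,
      Matrix.GeneralLinearGroup.mkOfDetNeZero] using hij
  rw [scaledDiscriminant, SL_slash, ← SlashAction.slash_mul, hM, SlashAction.slash_mul, ← SL_slash,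
    discriminant_slash]

lemma scaledDiscriminant_invariant {N d : ℕ} (hd : 0 < d) (hdN : d ∣ N) {γ : SL(2, ℤ)}
    (hγ : γ ∈ Gamma0 N) : scaledDiscriminant d hd ∣[(12 : ℤ)] γ = scaledDiscriminant d hd := by
  obtain ⟨b, e, he, h⟩ := scaledDiscriminant_slash hd γ
  have hgcd : d.gcd (γ 1 0).natAbs = d := Nat.gcd_eq_left
    (Int.natCast_dvd.mp ((Int.natCast_dvd_natCast.mpr hdN).trans (mem_Gamma0_iff_dvd.mp hγ)))
  simp only [hgcd] at h he
  obtain rfl : e = 1 := Nat.eq_of_mul_eq_mul_left hd (by rw [he, mul_one])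
  rw [h, scaledDiscriminant]
  ext τ
  rw [slash_upperTriangularGL_apply, slash_upperTriangularGL_apply]
  have hT := congrFun (discriminant_slash (ModularGroup.T ^ b))
    (upperTriangularGL d 0 1 (by simpa using hd) • τ)
  rw [slash_T_zpow_apply] at hT
  rw [← hT]
  congr 2
  · ext
    simp [coe_upperTriangularGL_smul, add_comm]
  · simp

lemma scaledDiscriminant_ne_zero {d : ℕ} (hd : 0 < d) (τ : ℍ) : scaledDiscriminant d hd τ ≠ 0 := by
  rw [scaledDiscriminant, slash_upperTriangularGL_apply]
  refine mul_ne_zero (ModularForm.discriminant_ne_zero _) ?_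
  have : (0 : ℝ) < d := by exact_mod_cast hd
  rw [Complex.ofReal_ne_zero]
  positivity

lemma mdifferentiable_scaledDiscriminant {d : ℕ} (hd : 0 < d) : MDiff (scaledDiscriminant d hd) :=
  CuspForm.discriminant.holo'.slash 12 _

lemma tendsto_discriminant_div_qParam :
    Tendsto (fun τ : ℍ ↦ ModularForm.discriminant τ / 𝕢 1 τ) atImInfty (𝓝 1) := by
  refine ModularForm.tendsto_atImInfty_tprod_one_sub_eta_q_pow.congr fun τ ↦ ?_
  rw [ModularForm.discriminant_eq_q_prod, mul_div_cancel_left₀ _ (Periodic.qParam_ne_zero _)]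

lemma tendsto_scaledDiscriminant {d : ℕ} (hd : 0 < d) :
    Tendsto (fun τ : ℍ ↦ scaledDiscriminant d hd τ / 𝕢 1 τ ^ d) atImInfty (𝓝 ((d : ℂ) ^ 11)) := by
  have h0 : (0 : ℝ) < d * 1 := by simpa using hd
  have h1 := (tendsto_discriminant_div_qParam.comp
    (tendsto_upperTriangularGL_smul (b := 0) h0)).mul_const ((d : ℂ) ^ 11)
  rw [one_mul] at h1
  refine h1.congr fun τ ↦ ?_
  have hq : 𝕢 1 (upperTriangularGL d 0 1 h0 • τ : ℍ) = 𝕢 1 τ ^ d := by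
    rw [coe_upperTriangularGL_smul, Periodic.qParam, Periodic.qParam, ← Complex.exp_nat_mul]
    congr 1
    push_cast
    ring
  rw [comp_apply, hq, scaledDiscriminant, slash_upperTriangularGL_apply]
  norm_num
  ring

/-- The order of `Δ(dτ)` at the cusp `g ∞`, in terms of `q`, is `gcd(d, g₁₀) ^ 2 / d`. This need not
be an integer, so the statement is about absolute values: `exp (2π Im τ) = |q|⁻¹`. -/
lemma exists_tendsto_norm_scaledDiscriminant_slash {d : ℕ} (hd : 0 < d) (g : SL(2, ℤ)) :
    ∃ K : ℝ, 0 < K ∧ Tendsto (fun τ : ℍ ↦ ‖(scaledDiscriminant d hd ∣[(12 : ℤ)] g) τ‖ *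
      Real.exp (2 * Real.pi * τ.im) ^ ((d.gcd (g 1 0).natAbs : ℝ) ^ 2 / d)) atImInfty (𝓝 K) := by
  obtain ⟨b, e, he, h⟩ := scaledDiscriminant_slash hd g
  set a := d.gcd (g 1 0).natAbs
  have heR : (a : ℝ) * e = d := by exact_mod_cast he
  have hdR : (0 : ℝ) < d := by exact_mod_cast hd
  have hae : (0 : ℝ) < a * e := by rw [heR]; exact hdR
  have he0 : (0 : ℝ) < e := pos_of_mul_pos_right hae (Nat.cast_nonneg a)
  have ha0 : (0 : ℝ) < a := pos_of_mul_pos_left hae (Nat.cast_nonneg e)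
  refine ⟨1 * ((a * e) ^ ((12 : ℤ) - 1) * e ^ (-(12 : ℤ))), by positivity, ?_⟩
  have h1 := (tendsto_discriminant_div_qParam.comp
    (tendsto_upperTriangularGL_smul (b := b) hae)).norm.mul_const
      ((a * e : ℝ) ^ ((12 : ℤ) - 1) * (e : ℝ) ^ (-(12 : ℤ)))
  rw [norm_one] at h1
  refine h1.congr fun τ ↦ ?_
  rw [h, slash_upperTriangularGL_apply, norm_mul, Complex.norm_real, comp_apply, norm_div,
    Periodic.norm_qParam, coe_upperTriangularGL_smul, Real.norm_of_nonneg (by positivity),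
    ← Real.exp_mul, div_eq_mul_inv _ (Real.exp _), ← Real.exp_neg]
  have e1 : -(-2 * Real.pi * (((a : ℝ) * (τ : ℂ) + (b : ℝ)) / (e : ℝ) : ℂ).im / 1) =
      2 * Real.pi * τ.im * ((a : ℝ) ^ 2 / d) := by
    rw [← heR, Complex.div_ofReal_im]
    simp
    field_simp
  rw [e1]
  ring

/-! ### Existence of strong modular forms -/

lemma pos_of_mem_divisorsAntidiagonal {N : ℕ} (x : {x // x ∈ N.divisorsAntidiagonal}) :
    0 < x.1.2 :=
  Nat.pos_of_mem_divisors (Nat.snd_mem_divisors_of_mem_antidiagonal x.2)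

/-- The exponent `d μ(N / d)` of `Δ(dτ)`, indexed by the factorization `N = (N / d) d`. -/
def discriminantExponent {N : ℕ} (x : {x // x ∈ N.divisorsAntidiagonal}) : ℤ :=
  x.1.2 * ArithmeticFunction.moebius x.1.1

/-- The product of the functions `Δ(dτ) ^ (d μ(N / d))` over the divisors `d` of `N`, up to a
constant factor. -/
def discriminantProduct (N : ℕ) (τ : ℍ) : ℂ :=
  ∏ x ∈ N.divisorsAntidiagonal.attach,
    scaledDiscriminant x.1.2 (pos_of_mem_divisorsAntidiagonal x) τ ^ discriminantExponent x

section discriminantProduct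

variable {N : ℕ}

lemma sum_discriminantExponent (hN : 0 < N) :
    ∑ x ∈ N.divisorsAntidiagonal.attach, discriminantExponent x = N.totient := by
  rw [← sum_moebius_mul_eq_totient hN]
  exact Finset.sum_attach _ fun x : ℕ × ℕ ↦ (x.2 : ℤ) * ArithmeticFunction.moebius x.1

lemma discriminantProduct_slash (hN : 0 < N) (g : SL(2, ℤ)) (τ : ℍ) :
    (discriminantProduct N ∣[(12 * N.totient : ℤ)] g) τ =
      ∏ x ∈ N.divisorsAntidiagonal.attach,
        (scaledDiscriminant x.1.2 (pos_of_mem_divisorsAntidiagonal x) ∣[(12 : ℤ)] g) τ ^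
          discriminantExponent x := by
  simp only [SL_slash_apply, mul_zpow, Finset.prod_mul_distrib, discriminantProduct]
  congr 1
  simp only [← zpow_mul]
  rw [prod_zpow_eq_zpow_sum _ _ (denom_ne_zero _ _), ← Finset.mul_sum, sum_discriminantExponent hN]
  congr 1

lemma discriminantProduct_invariant (hN : 0 < N) {γ : SL(2, ℤ)} (hγ : γ ∈ Gamma0 N) :
    discriminantProduct N ∣[(12 * N.totient : ℤ)] γ = discriminantProduct N := by
  ext τ
  rw [discriminantProduct_slash hN]
  refine Finset.prod_congr rfl fun x _ ↦ ?_
  rw [scaledDiscriminant_invariant _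
    (Nat.dvd_of_mem_divisors (Nat.snd_mem_divisors_of_mem_antidiagonal x.2)) hγ]

lemma discriminantProduct_ne_zero (τ : ℍ) : discriminantProduct N τ ≠ 0 :=
  Finset.prod_ne_zero_iff.mpr fun _ _ ↦ zpow_ne_zero _ (scaledDiscriminant_ne_zero _ τ)

lemma mdifferentiable_discriminantProduct : MDiff (discriminantProduct N) := by
  rw [UpperHalfPlane.mdifferentiable_iff]
  change DifferentiableOn ℂ (fun z ↦ ∏ x ∈ N.divisorsAntidiagonal.attach,
    (scaledDiscriminant x.1.2 (pos_of_mem_divisorsAntidiagonal x) ∘ ofComplex) z ^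
      discriminantExponent x) _
  refine DifferentiableOn.fun_finsetProd fun x _ ↦ ?_
  exact (UpperHalfPlane.mdifferentiable_iff.mp (mdifferentiable_scaledDiscriminant _)).zpow
    (Or.inl fun z _ ↦ scaledDiscriminant_ne_zero _ _)

/-- At `∞` the order of the product is `∑ d ^ 2 μ(N / d) = J₂(N)`. -/
lemma exists_tendsto_discriminantProduct_div (hN : 0 < N) :
    ∃ n : ℕ, 0 < n ∧ ∃ c : ℂ, c ≠ 0 ∧
      Tendsto (fun τ : ℍ ↦ discriminantProduct N τ / 𝕢 1 τ ^ n) atImInfty (𝓝 c) := by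
  obtain ⟨n, hn⟩ := Int.eq_ofNat_of_zero_le (sum_moebius_mul_sq_pos hN).le
  have hn0 := sum_moebius_mul_sq_pos hN
  rw [hn] at hn0
  have hsum : ∑ x ∈ N.divisorsAntidiagonal.attach, (x.1.2 : ℤ) * discriminantExponent x = n := by
    rw [← hn, ← Finset.sum_attach N.divisorsAntidiagonal]
    refine Finset.sum_congr rfl fun x _ ↦ ?_
    rw [discriminantExponent]
    ring
  have hd (x : {x // x ∈ N.divisorsAntidiagonal}) : (x.1.2 : ℂ) ^ 11 ≠ 0 :=
    pow_ne_zero _ (by exact_mod_cast (pos_of_mem_divisorsAntidiagonal x).ne')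
  refine ⟨n, by exact_mod_cast hn0, ∏ x ∈ N.divisorsAntidiagonal.attach,
    ((x.1.2 : ℂ) ^ 11) ^ discriminantExponent x,
    Finset.prod_ne_zero_iff.mpr fun x _ ↦ zpow_ne_zero _ (hd x), ?_⟩
  refine (tendsto_finsetProd N.divisorsAntidiagonal.attach fun x _ ↦
    (tendsto_scaledDiscriminant (pos_of_mem_divisorsAntidiagonal x)).zpow₀
      (discriminantExponent x) (Or.inl (hd x))).congr fun τ ↦ ?_
  simp only [div_zpow, Finset.prod_div_distrib, discriminantProduct]
  congr 1
  simp only [← zpow_natCast, ← zpow_mul]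
  rw [prod_zpow_eq_zpow_sum _ _ (Periodic.qParam_ne_zero _), hsum]

/-- At the cusps that are not equivalent to `∞`, the orders of the factors of the product cancel,
as `∑ μ(N / d) gcd(d, c) ^ 2 = 0` when `N` does not divide `c`. -/
lemma exists_tendsto_norm_discriminantProduct_slash (hN : 0 < N) {g : SL(2, ℤ)}
    (hg : g ∉ Gamma0 N) : ∃ K : ℝ, 0 < K ∧
      Tendsto (fun τ ↦ ‖(discriminantProduct N ∣[(12 * N.totient : ℤ)] g) τ‖) atImInfty
        (𝓝 K) := by
  have hc : ¬ N ∣ (g 1 0).natAbs := fun h ↦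
    hg (mem_Gamma0_iff_dvd.mpr (Int.natCast_dvd.mpr h))
  have hsum : ∑ x ∈ N.divisorsAntidiagonal.attach,
      (x.1.2.gcd (g 1 0).natAbs : ℝ) ^ 2 / x.1.2 * discriminantExponent x = 0 := by
    have h := congrArg (Int.cast (R := ℝ)) (sum_moebius_mul_gcd_sq_eq_zero hN hc)
    rw [← Finset.sum_attach N.divisorsAntidiagonal] at h
    push_cast at h
    rw [← h]
    refine Finset.sum_congr rfl fun x _ ↦ ?_
    have : (x.1.2 : ℝ) ≠ 0 := by exact_mod_cast (pos_of_mem_divisorsAntidiagonal x).ne'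
    rw [discriminantExponent]
    push_cast
    field_simp
  choose K hK hlim using fun x : {x // x ∈ N.divisorsAntidiagonal} ↦
    exists_tendsto_norm_scaledDiscriminant_slash (pos_of_mem_divisorsAntidiagonal x) g
  refine ⟨∏ x ∈ N.divisorsAntidiagonal.attach, K x ^ discriminantExponent x,
    Finset.prod_pos fun x _ ↦ zpow_pos (hK x) _, ?_⟩
  refine (tendsto_finsetProd N.divisorsAntidiagonal.attach fun x _ ↦
    (hlim x).zpow₀ (discriminantExponent x) (Or.inl (hK x).ne')).congr fun τ ↦ ?_
  rw [discriminantProduct_slash hN, norm_prod]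
  simp only [mul_zpow, Finset.prod_mul_distrib, norm_zpow]
  refine ((congrArg _ ?_).trans (mul_one _))
  simp only [← Real.rpow_intCast, ← Real.rpow_mul (Real.exp_pos _).le]
  rw [← Real.rpow_sum_of_pos (Real.exp_pos _), hsum, Real.rpow_zero]

lemma exists_isStrongModularForm (hN : 0 < N) :
    ∃ ρ : ℕ, 0 < ρ ∧ ∃ D : ModForms N ρ, IsStrongModularForm D := by
  obtain ⟨n, hn, c, hc, hlim⟩ := exists_tendsto_discriminantProduct_div hN
  have hw : ((12 * N.totient : ℕ) : ℤ) = 12 * N.totient := by push_cast; rfl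
  refine ⟨12 * N.totient, by have := Nat.totient_pos.mpr hN; omega, ?_⟩
  rw [hw]
  have hinv (γ : SL(2, ℤ)) (hγ : γ ∈ Gamma0 N) :
      (c⁻¹ • discriminantProduct N) ∣[(12 * N.totient : ℤ)] γ = c⁻¹ • discriminantProduct N := by
    rw [SL_smul_slash, discriminantProduct_invariant hN hγ]
  have hhol : MDiff (c⁻¹ • discriminantProduct N) :=
    mdifferentiable_discriminantProduct.const_smul c⁻¹
  have hlim' : Tendsto (fun τ : ℍ ↦ (c⁻¹ • discriminantProduct N) τ / 𝕢 1 τ ^ n) atImInfty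
      (𝓝 1) := by
    have := hlim.const_mul c⁻¹
    rw [inv_mul_cancel₀ hc] at this
    exact this.congr fun τ ↦ by simp [mul_div_assoc]
  have hnorm (g : SL(2, ℤ)) (hg : g ∉ Gamma0 N) : ∃ K : ℝ, 0 < K ∧ Tendsto
      (fun τ ↦ ‖((c⁻¹ • discriminantProduct N) ∣[(12 * N.totient : ℤ)] g) τ‖) atImInfty
        (𝓝 K) := by
    obtain ⟨K, hK, h⟩ := exists_tendsto_norm_discriminantProduct_slash hN hg
    refine ⟨‖c⁻¹‖ * K, mul_pos (norm_pos_iff.mpr (inv_ne_zero hc)) hK, ?_⟩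
    refine (h.const_mul ‖c⁻¹‖).congr fun τ ↦ ?_
    rw [SL_smul_slash, Pi.smul_apply, norm_smul]
  have h0 : IsZeroAtImInfty (c⁻¹ • discriminantProduct N) := by
    have := tendsto_of_tendsto_div_qParam_pow hn hlim'
    simp only [pow_zero, div_one] at this
    exact this
  refine ⟨modularFormOfInvariant hN (c⁻¹ • discriminantProduct N) hinv hhol
    h0.isBoundedAtImInfty fun g hg ↦ ?_, h0, fun τ ↦ ?_, fun s hs hns ↦ ?_, n, ?_, ?_⟩
  · obtain ⟨K, -, h⟩ := hnorm g hg
    exact Asymptotics.isBigO_norm_left.mp (h.isBigO_one ℝ)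
  · exact mul_ne_zero (inv_ne_zero hc) (discriminantProduct_ne_zero τ)
  · obtain ⟨g, rfl⟩ := exists_SL2Z_of_isCusp_GammaZero hN hs
    have hg : g ∉ Gamma0 N := fun hg ↦ hns _ (Subgroup.mem_map_of_mem _ hg) rfl
    obtain ⟨K, hK, h⟩ := hnorm g hg
    intro hz
    have h1 := (hz _ rfl).norm
    rw [norm_zero] at h1
    exact hK.ne (tendsto_nhds_unique h1 h)
  · exact valuation_eq_of_tendsto (periodic_of_invariant hinv) hhol one_ne_zero hlim'
  · exact (coeff_of_tendsto_div_qParam_pow (periodic_of_invariant hinv) hhol hlim').2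

end discriminantProduct

/-- Weights of strong modular forms being natural numbers, the least one is attained, so that the
default value `0` in the definition of `deltaForm` does not occur. -/
lemma isStrongModularForm_deltaForm {N : ℕ} (hN : 0 < N) : IsStrongModularForm (deltaForm N) := by
  obtain ⟨ρ, -, D, hD⟩ := exists_isStrongModularForm hN
  have h : ∃ D : ModForms N (deltaWeight N), IsStrongModularForm D :=
    Nat.sInf_mem (s := {ρ : ℕ | ∃ D : ModForms N ρ, IsStrongModularForm D}) ⟨ρ, D, hD⟩
  rw [deltaForm, dif_pos h]
  exact h.choose_spec

end

theorem mainTheorem4 (N : ℕ) (hN : 0 < N) :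
    -- `Δ_N` exists, and what follows holds for it and for every other strong modular form
    IsStrongModularForm (deltaForm N) ∧
    ∀ (ρ : ℕ) (D : ModForms N ρ), IsStrongModularForm D → ∀ k : ℕ, 1 ≤ k →
      -- multiplication by `D` is an isomorphism onto the cusp forms of valuation `> ν(D)`
      (Function.Injective (mulCusp D (2 * k)) ∧
        ∀ Φ : CuspForms N (2 * k + ρ),
          Φ ∈ LinearMap.range (mulCusp D (2 * k)) ↔ valuation D < valuation Φ) ∧
      -- the direct sum decomposition
      (∀ G : Module.Basis (Fin (cuspDim N (2 * k + ρ))) ℂ (CuspForms N (2 * k + ρ)),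
        IsUnitaryUpperTriangular G →
        IsCompl (Submodule.span ℂ {f | ∃ i, f = G i ∧ valuation (G i) ≤ valuation D})
          (LinearMap.range (mulCusp D (2 * k)))) ∧
      -- the choice of the higher basis elements (indices start at `0` here)
      (∃ F : Module.Basis (Fin (cuspDim N (2 * k))) ℂ (CuspForms N (2 * k)),
        IsUnitaryUpperTriangular F) ∧
      (∀ F : Module.Basis (Fin (cuspDim N (2 * k))) ℂ (CuspForms N (2 * k)),
        IsUnitaryUpperTriangular F →
        ∃ G : Module.Basis (Fin (cuspDim N (2 * k + ρ))) ℂ (CuspForms N (2 * k + ρ)),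
          IsUnitaryUpperTriangular G ∧
          (∀ i : Fin (cuspDim N (2 * k + ρ)),
            Nat.card {j // valuation (G j) ≤ valuation D} ≤ (i : ℕ) →
            ∃ j : Fin (cuspDim N (2 * k)),
              (i : ℕ) = Nat.card {j // valuation (G j) ≤ valuation D} + j ∧
              G i = mulCusp D (2 * k) (F j)) ∧
          (2 ≤ k → ∀ i : Fin (cuspDim N (2 * k + ρ)), valuation D ≤ (i : ℕ) →
            ∃ j : Fin (cuspDim N (2 * k)), ((i : ℕ) : ℕ∞) = valuation D + (j : ℕ) ∧
              G i = mulCusp D (2 * k) (F j))) := by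
  refine ⟨isStrongModularForm_deltaForm hN, fun ρ D hD k hk ↦ ?_⟩
  -- the weight of `D` is not assumed to be positive, so the constructed strong form is used here
  have hfin (k : ℤ) : FiniteDimensional ℂ (CuspForms N k) := by
    obtain ⟨ρ₀, hρ₀, D₀, hD₀⟩ := exists_isStrongModularForm hN
    exact hD₀.finiteDimensional hN (by exact_mod_cast hρ₀) k
  refine ⟨⟨hD.mulCusp_injective _, hD.mem_range_mulCusp_iff hN⟩,
    fun G hG ↦ hD.isCompl_range_mulCusp hN hG, exists_isUnitaryUpperTriangular, fun F hF ↦ ?_⟩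
  obtain ⟨G, hG, hGF⟩ := hD.exists_isUnitaryUpperTriangular_extending hN hF
  refine ⟨G, hG, hGF, fun hk2 i hi ↦ ?_⟩
  obtain ⟨n, hn, -⟩ := hD.isUnitary
  have hcard : Nat.card {j // valuation (G j) ≤ valuation D} = n := by
    rw [hn]
    exact hG.card_valuation_le fun t h1 ht ↦
      exists_cuspForm_valuation_eq hN (by omega) (even_two_mul _) hn h1 ht
  rw [hcard] at hGF
  rw [hn] at hi ⊢
  obtain ⟨j, hj, hj'⟩ := hGF i (by exact_mod_cast hi)
  exact ⟨j, by rw [hj, Nat.cast_add], hj'⟩
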